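/- **Setting (finite graphs).** Let $G=(V\cup\{\delta\},E)$ be a finite directed graph without multiple edges and without loops (edges $(x,x)$), in which $\delta\notin V$ is a cemetery vertex: no edge exits $\delta$, and from every vertex there is a directed path to $\delta$. Suppose that $(x,y)\in E$ and $y\neq\delta$ imply $(y,x)\in E$. Let $(\alpha(e))_{e\in E}$ be positive real numbers. A random environment $\omega=(\omega(e))_{e\in E}$ is drawn from the law $\mathbb P^{(\alpha)}$ under which the families $(\omega(x,y))_{y:(x,y)\in E}$, $x\in V$, are independent, the family at $x$ having the Dirichlet law with parameters $(\alpha(x,y))_{y:(x,y)\in E}$. Given $\omega$, let $(Z_n)_{n\ge0}$ be, under $P^\omega_x$, the Markov chain started at $x$ that jumps from $y\in V$ to $z$ with probability $\omega(y,z)$ and stays at $\delta$ once it is there. For $x \in V$ put $$\gamma^\omega(x)=\frac1{P^\omega_x\big(H_\delta<\tilde H_x\wedge L\big)},$$ where $H_\delta=\inf\{n\ge0: Z_n=\delta\}$, $\tilde H_x=\inf\{n\ge1:Z_n=x\}$ and $L=\inf\{n\ge1:\exists\, m<n,\ Z_n=Z_m\}$. For $A\subset E$ let $\underline A$ and $\overline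 A$ be the sets of tails and of heads of the edges in $A$; $A$ is strongly connected if for all $x,y\in\underline A\cup\overline A$ there is a directed path from $x$ to $y$ with edges in $A$. Let $\beta_A$ be the sum of $\alpha(x,y)$ over the edges $(x,y)\in E$ with $x\in\underline A$ and $y\notin\underline A$. **Theorem.** (1) Let $0\in V$, and let $\beta=\min_A\beta_A$, where the minimum is over the strongly connected sets $A\subset E$ with $0\in\underline A$. If there is such a set $A$, then there are constants $C,r>0$ such that, for all $t$ large enough, $$\mathbb P^{(\alpha)}\big(\gamma^\omega(0)>t\big)\le C\,\frac{(\ln t)^r}{t^{\beta}}.$$ If there is no such set $A$ (that is, $\beta=+\infty$), then $\mathbb P^{(\alpha)}(\gamma^\omega(0)>t)=0$ for all $t$ large enough. (2) Let $d\ge1$, let $e_1,\dots,e_d$ be the canonical basis of $\mathbb Z^d$ and $e_{i+d}=-e_i$, let $\alpha_1,\dots,\alpha_{2d}>0$, and let $\mathbb P^{(\alpha)}$ be the law of the environment on $\mathbb Z^d$ for which the vectors $(\omega(x,x+e_i))_{1\le i\le 2d}$, $x\in\mathbb Z^d$, are i.i.d. with the Dirichlet law with parameters $(\alpha_1,\dots,\alpha_{2d})$.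 Let $\Lambda\subset\mathbb Z^d$ be a finite connected set that contains the origin, and let $\gamma^\omega(x)=1/\sum_\sigma\omega_\sigma$, where the sum is over the simple nearest-neighbour paths $\sigma$ that start at $x$ and stop just after exiting $x+\Lambda$, and $\omega_\sigma$ is the product of $\omega(e)$ over the edges $e$ of $\sigma$. Put $$\kappa=2\sum_{i=1}^{2d}\alpha_i-\max_{1\le i\le d}(\alpha_i+\alpha_{i+d}).$$ Then $\mathbb E^{(\alpha)}\big[\gamma^\omega(x)^s\big]<\infty$ for all $x\in\mathbb Z^d$ and all real $s<\kappa$. -/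

import Mathlib

open MeasureTheory ProbabilityTheory Filter
open scoped ENNReal

noncomputable section

namespace RWDE

/-! ### Dirichlet laws -/

/-- The open simplex `{x ∈ (0,1]^ι : ∑ i, x i = 1}` (the bound `x i ≤ 1` is automatic). -/
def openSimplex (ι : Type*) [Fintype ι] : Set (ι → ℝ) :=
  {x | (∀ i, 0 < x i) ∧ ∑ i, x i = 1}

/-- The open simplex as a type. -/
abbrev Simplex (ι : Type*) [Fintype ι] : Type _ := openSimplex ι

open scoped Classical in
/-- The map that completes a vector indexed by `ι ∖ {i₀}` by the coordinate
`x i₀ = 1 - ∑_{j ≠ i₀} x j`. -/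
def complete {ι : Type*} [Fintype ι] (i₀ : ι) (x : {i : ι // i ≠ i₀} → ℝ) : ι → ℝ :=
  fun i => if h : i = i₀ then 1 - ∑ j, x j else x ⟨i, h⟩

open scoped Classical in
/-- The measure `∏_{j ≠ i₀} dx_j` on the simplex: the image of Lebesgue measure under
the completion map, restricted to the simplex. -/
def simplexMeasure {ι : Type*} [Fintype ι] (i₀ : ι) : Measure (Simplex ι) :=
  ((volume : Measure ({i : ι // i ≠ i₀} → ℝ)).map (complete i₀)).comap Subtype.val

/-- The Dirichlet density with parameters `α`. -/
def dirichletDensity {ι : Type*} [Fintype ι] (α : ι → ℝ) (x : Simplex ι) : ℝ≥0∞ :=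
  ENNReal.ofReal
    (Real.Gamma (∑ i, α i) / (∏ i, Real.Gamma (α i)) * ∏ i, x.1 i ^ (α i - 1))

open scoped Classical in
/-- The Dirichlet law with parameters `α` (a law on a nonempty index set; the law does not
depend on the coordinate that is eliminated). -/
def dirichlet {ι : Type*} [Fintype ι] (α : ι → ℝ) : Measure (Simplex ι) :=
  if h : Nonempty ι then (simplexMeasure h.some).withDensity (dirichletDensity α) else 0

/-! ### Finite directed graphs with a cemetery vertex -/

section FiniteGraph

variable {W : Type*} [Fintype W]

/-- `δ` is a cemetery vertex: no edge exits `δ`, and every vertex is connected to `δ`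
through a directed path. -/
def IsCemetery (G : Digraph W) (δ : W) : Prop :=
  (∀ y, ¬ G.Adj δ y) ∧ ∀ x, Relation.ReflTransGen G.Adj x δ

/-- The heads of the edges that exit `x`; as there are no multiple edges, they stand for
the edges themselves. -/
abbrev Out (G : Digraph W) (x : W) : Type _ := {y : W // G.Adj x y}

open scoped Classical in
/-- Environments: at each vertex other than `δ`, positive exit probabilities along the edges
that exit the vertex, with sum `1`. -/
abbrev Env (G : Digraph W) (δ : W) : Type _ :=
  (x : {x : W // x ≠ δ}) → Simplex (Out G x.1)

open scoped Classical in
/-- The law of the Dirichlet environment with weights `α`: the exit probabilities at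
different vertices are independent, with Dirichlet laws. Only the weights of edges matter. -/
def envLaw (G : Digraph W) (δ : W) (α : W → W → ℝ) : Measure (Env G δ) :=
  Measure.pi fun x => dirichlet fun y : Out G x.1 => α x.1 y.1

open scoped Classical in
/-- The exit distribution given by a point of the simplex over the edges exiting `x`. -/
def exitPMF {G : Digraph W} {x : W} (p : Simplex (Out G x)) : PMF (Out G x) :=
  PMF.ofFintype (fun y => ENNReal.ofReal (p.1 y)) (by
    rw [← ENNReal.ofReal_sum_of_nonneg fun y _ => (p.2.1 y).le, p.2.2, ENNReal.ofReal_one])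

open scoped Classical in
/-- One step of the walk in the environment `ω`; the walk stays at `δ` once it is there. -/
def step {G : Digraph W} {δ : W} (ω : Env G δ) (x : W) : PMF W :=
  if h : x = δ then PMF.pure δ else (exitPMF (ω ⟨x, h⟩)).map Subtype.val

variable [MeasurableSpace W] [DiscreteMeasurableSpace W]

/-- The transition kernel of the walk in the environment `ω`. -/
def stepKernel {G : Digraph W} {δ : W} (ω : Env G δ) : Kernel W W :=
  Kernel.ofFunOfCountable fun x => (step ω x).toMeasure

instance {G : Digraph W} {δ : W} (ω : Env G δ) : IsMarkovKernel (stepKernel ω) :=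
  ⟨fun x => inferInstanceAs (IsProbabilityMeasure (step ω x).toMeasure)⟩

/-- The conditional law of `Z (n + 1)` given `Z 0, …, Z n`: a step from `Z n`. -/
def nextKernel {G : Digraph W} {δ : W} (ω : Env G δ) (n : ℕ) :
    Kernel (Finset.Iic n → W) W :=
  (stepKernel ω).comap (fun z => z ⟨n, Finset.mem_Iic.2 le_rfl⟩) (measurable_pi_apply _)

instance {G : Digraph W} {δ : W} (ω : Env G δ) (n : ℕ) : IsMarkovKernel (nextKernel ω n) :=
  inferInstanceAs (IsMarkovKernel ((stepKernel ω).comap _ _))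

/-- The quenched law `P_x^ω` on trajectories `(Z n)` of the walk started at `x`. -/
def walkLaw {G : Digraph W} {δ : W} (ω : Env G δ) (x : W) : Measure (ℕ → W) :=
  Kernel.traj (X := fun _ => W) (nextKernel ω) 0 fun _ => x

/-- The hitting time `H_y = inf {n ≥ 0 : Z n = y}`. -/
def hitTime (y : W) (Z : ℕ → W) : ℕ∞ := ⨅ (n : ℕ) (_ : Z n = y), (n : ℕ∞)

/-- The return time `inf {n ≥ 1 : Z n = y}`. -/
def returnTime (y : W) (Z : ℕ → W) : ℕ∞ := ⨅ (n : ℕ) (_ : 1 ≤ n ∧ Z n = y), (n : ℕ∞)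

/-- The time of the first loop `L = inf {n ≥ 1 : Z n = Z m for some m < n}`. -/
def loopTime (Z : ℕ → W) : ℕ∞ :=
  ⨅ (n : ℕ) (_ : 1 ≤ n ∧ ∃ m < n, Z n = Z m), (n : ℕ∞)

/-- `γ^ω(x)`, the inverse of the `P_x^ω`-probability to reach `δ` before returning to `x` and
before the first loop. -/
def gamma {G : Digraph W} {δ : W} (ω : Env G δ) (x : W) : ℝ≥0∞ :=
  (walkLaw ω x {Z | hitTime δ Z < min (returnTime x Z) (loopTime Z)})⁻¹

end FiniteGraph

section ExitSums

variable {W : Type*} [Fintype W]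

/-- The tails of the edges in `A`. -/
def tails (A : Set (W × W)) : Set W := Prod.fst '' A

/-- The heads of the edges in `A`. -/
def heads (A : Set (W × W)) : Set W := Prod.snd '' A

/-- `A` is a strongly connected set of edges of `G`: any two endpoints of edges in `A` are
joined by a directed path in `A`. -/
def IsStronglyConnected (G : Digraph W) (A : Set (W × W)) : Prop :=
  (∀ e ∈ A, G.Adj e.1 e.2) ∧
    ∀ x ∈ heads A ∪ tails A, ∀ y ∈ heads A ∪ tails A,
      Relation.ReflTransGen (fun a b => (a, b) ∈ A) x y

open scoped Classical in
/-- `β_A`, the sum of the weights of the edges that exit the vertex set of `A`. -/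
def exitSum (G : Digraph W) (α : W → W → ℝ) (A : Set (W × W)) : ℝ :=
  ∑ e : W × W with G.Adj e.1 e.2 ∧ e.1 ∈ tails A ∧ e.2 ∉ tails A, α e.1 e.2

/-- The numbers `β_A`, for the strongly connected sets `A` of edges that contain `o`. -/
def exitSums (G : Digraph W) (α : W → W → ℝ) (o : W) : Set ℝ :=
  {b | ∃ A : Set (W × W), IsStronglyConnected G A ∧ o ∈ tails A ∧ b = exitSum G α A}

end ExitSums

/-! ### The lattice `ℤ^d` -/

/-- The `2d` directions: `Sum.inl i` stands for `e_i` and `Sum.inr i` for `e_{i+d} = -e_i`. -/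
abbrev Dir (d : ℕ) : Type := Fin d ⊕ Fin d

/-- The unit vector of a direction. -/
def unitVec {d : ℕ} : Dir d → (Fin d → ℤ)
  | Sum.inl i => Pi.single i 1
  | Sum.inr i => -Pi.single i 1

/-- Environments on `ℤ^d`; `(ω x).1 i` is the probability to jump from `x` to `x + e_i`. -/
abbrev LatticeEnv (d : ℕ) : Type := (Fin d → ℤ) → Simplex (Dir d)

/-- The law of the i.i.d. Dirichlet environment on `ℤ^d` with parameters `α`. -/
def latticeLaw {d : ℕ} (α : Dir d → ℝ) : Measure (LatticeEnv d) :=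
  Measure.infinitePi fun _ => dirichlet α

/-- The set `Λ` of vertices of `ℤ^d` is connected. -/
def IsConnectedSet {d : ℕ} (Λ : Finset (Fin d → ℤ)) : Prop :=
  ∀ x ∈ Λ, ∀ y ∈ Λ,
    Relation.ReflTransGen (fun a b => b ∈ Λ ∧ ∃ i : Dir d, b = a + unitVec i) x y

/-- The vertices visited after the start by the path from `x` with the given steps. -/
def trail {d : ℕ} : (Fin d → ℤ) → List (Dir d) → List (Fin d → ℤ)
  | _, [] => []
  | x, i :: σ => (x + unitVec i) :: trail (x + unitVec i) σ

/-- `ω_σ`, the product of the `ω(e)` along the edges of the path from `x` with the given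
steps. -/
def pathWeight {d : ℕ} (ω : LatticeEnv d) : (Fin d → ℤ) → List (Dir d) → ℝ
  | _, [] => 1
  | x, i :: σ => (ω x).1 i * pathWeight ω (x + unitVec i) σ

/-- The path from `x` with steps `σ` is simple, and it stops just after exiting `x + Λ`. -/
def IsExitPath {d : ℕ} (Λ : Finset (Fin d → ℤ)) (x : Fin d → ℤ) (σ : List (Dir d)) : Prop :=
  (x :: trail x σ).Nodup ∧
    (∀ y ∈ (x :: trail x σ).dropLast, y - x ∈ Λ) ∧
    (x :: trail x σ).getLast (List.cons_ne_nil _ _) - x ∉ Λ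

/-- The accelerating function on `ℤ^d`: the inverse of the sum of `ω_σ` over the simple paths
`σ` from `x` stopped just after exiting `x + Λ`. -/
def latticeGamma {d : ℕ} (Λ : Finset (Fin d → ℤ)) (ω : LatticeEnv d) (x : Fin d → ℤ) : ℝ≥0∞ :=
  (∑' σ : {σ : List (Dir d) // IsExitPath Λ x σ}, ENNReal.ofReal (pathWeight ω x σ.1))⁻¹

/-- `κ = 2 ∑_{i ≤ 2d} α_i - max_{i ≤ d} (α_i + α_{i+d})`. -/
def kappa {d : ℕ} (α : Dir d → ℝ) : ℝ :=
  2 * ∑ i, α i - ⨆ i : Fin d, (α (Sum.inl i) + α (Sum.inr i))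

end RWDE

end

/-!
Give each edge `e` the length `-log ω(e)`, so that `γ` is at most the exponential of the distance
`T` from the starting point to the exit along simple paths. The balls of radius below `T` do not
meet the exit, and as soon as they contain one edge the weights `α` of the edges that exit them sum
to at least `β` (resp. `κ`). Integrating these sums over the radius, and noting that an edge exits
the ball only for a set of radii of measure at most its length, gives the length–width inequality
`β (T - c) ≤ ∑ α(e) (-log ω(e))`, that is, `γ ^ β ≤ const · ∏ ω(e) ^ (-α(e))`. The right-hand side
is barely not integrable: with the exponents `-(α(e) - ε)` its Dirichlet expectation is of order
`ε ^ (-m)`, where `m` is the number of edges. This bounds the moments of order `s < β` at once, and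
Markov's inequality at `ε = 1 / log t` gives the tail.
-/

namespace RWDE

section LintegralPi

variable {ι : Type*} {X : ι → Type*} [∀ i, MeasurableSpace (X i)]

open scoped Classical in
lemma lmarginal_prod (μ : ∀ i, Measure (X i)) [∀ i, SigmaFinite (μ i)] {f : ∀ i, X i → ℝ≥0∞}
    (hf : ∀ i, Measurable (f i)) (s : Finset ι) :
    lmarginal μ s (fun x => ∏ i ∈ s, f i (x i)) = fun _ => ∏ i ∈ s, ∫⁻ x, f i x ∂μ i := by
  have hmeas (s : Finset ι) : Measurable fun x : ∀ i, X i => ∏ i ∈ s, f i (x i) :=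
    Finset.measurable_prod s fun i _ => (hf i).comp (measurable_pi_apply i)
  induction s using Finset.induction_on with
  | empty => simp
  | insert j s hj ih =>
    have hslice (x : ∀ i, X i) :
        ∫⁻ y, ∏ i ∈ insert j s, f i (Function.update x j y i) ∂μ j =
          (∫⁻ y, f j y ∂μ j) * ∏ i ∈ s, f i (x i) := by
      rw [← lintegral_mul_const _ (hf j)]
      refine lintegral_congr fun y => ?_
      rw [Finset.prod_insert hj, Function.update_self]
      congr 1
      exact Finset.prod_congr rfl fun i hi => by
        rw [Function.update_of_ne (ne_of_mem_of_not_mem hi hj)]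
    rw [lmarginal_insert' _ (hmeas _) hj, funext hslice]
    ext x
    rw [Finset.prod_insert hj, ← congrFun ih x]
    exact lintegral_const_mul _ ((hmeas s).comp measurable_updateFinset)

lemma lintegral_pi_prod [Fintype ι] (μ : ∀ i, Measure (X i)) [∀ i, SigmaFinite (μ i)]
    {f : ∀ i, X i → ℝ≥0∞} (hf : ∀ i, Measurable (f i)) :
    ∫⁻ x, ∏ i, f i (x i) ∂Measure.pi μ = ∏ i, ∫⁻ x, f i x ∂μ i := by
  classical
  rcases isEmpty_or_nonempty (∀ i, X i) with _ | ⟨⟨x⟩⟩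
  · obtain ⟨i, _⟩ := isEmpty_pi.1 ‹IsEmpty (∀ i, X i)›
    rw [Subsingleton.elim (Measure.pi μ) 0, lintegral_zero_measure, eq_comm]
    exact Finset.prod_eq_zero (Finset.mem_univ i) (by
      rw [Subsingleton.elim (μ i) 0, lintegral_zero_measure])
  · rw [lintegral_eq_lmarginal_univ x, lmarginal_prod μ hf]

end LintegralPi

section GammaDensity

/-- The density of the Gamma law with shape `a` and rate `1`, made to vanish at `0` too. -/
noncomputable def gammaDensity (a : ℝ) : ℝ → ℝ≥0∞ :=
  (Set.Ioi 0).indicator (gammaPDF a 1)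

lemma gammaDensity_of_pos (a : ℝ) {x : ℝ} (hx : 0 < x) :
    gammaDensity a x = ENNReal.ofReal ((Real.Gamma a)⁻¹ * x ^ (a - 1) * Real.exp (-x)) := by
  simp [gammaDensity, Set.indicator_of_mem (Set.mem_Ioi.2 hx), gammaPDF_of_nonneg hx.le]

lemma gammaDensity_of_nonpos (a : ℝ) {x : ℝ} (hx : x ≤ 0) : gammaDensity a x = 0 :=
  Set.indicator_of_notMem (s := Set.Ioi 0) (not_lt.2 hx) _

lemma measurable_gammaDensity (a : ℝ) : Measurable (gammaDensity a) :=
  (measurable_gammaPDFReal a 1).ennreal_ofReal.indicator measurableSet_Ioi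

lemma lintegral_gammaDensity {a : ℝ} (ha : 0 < a) : ∫⁻ x, gammaDensity a x = 1 := by
  have hIic : ∫⁻ x in Set.Iic 0, gammaPDF a 1 x = 0 := by
    rw [setLIntegral_congr Iio_ae_eq_Iic.symm, lintegral_gammaPDF_of_nonpos le_rfl]
  rw [gammaDensity, lintegral_indicator measurableSet_Ioi, ← Set.compl_Iic,
    ← zero_add (∫⁻ x in _, _), ← hIic, lintegral_add_compl _ measurableSet_Iic,
    lintegral_gammaPDF_eq_one ha one_pos]

end GammaDensity

section SumChart

variable {ι : Type*} [Fintype ι]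

open scoped Classical in
/-- The vector with coordinates `x` off `i₀` whose sum is `s`; `complete` is the case `s = 1`. -/
noncomputable def completeTo (i₀ : ι) (s : ℝ) (x : {i : ι // i ≠ i₀} → ℝ) : ι → ℝ :=
  fun i => if h : i = i₀ then s - ∑ j, x j else x ⟨i, h⟩

open scoped Classical in
lemma sum_completeTo (i₀ : ι) (s : ℝ) (x : {i : ι // i ≠ i₀} → ℝ) :
    ∑ i, completeTo i₀ s x i = s := by
  have hne : ∑ i : {i : ι // i ≠ i₀}, completeTo i₀ s x i = ∑ j, x j :=
    Finset.sum_congr rfl fun j _ => by simp [completeTo, j.2]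
  rw [Fintype.sum_eq_add_sum_subtype_ne _ i₀, hne]
  simp [completeTo]

open scoped Classical in
lemma completeTo_smul (i₀ : ι) (s : ℝ) (x : {i : ι // i ≠ i₀} → ℝ) :
    completeTo i₀ s (s • x) = s • complete i₀ x := by
  ext i
  by_cases h : i = i₀
  · simp [completeTo, complete, h, mul_sub, Finset.mul_sum]
  · simp [completeTo, complete, h]

open scoped Classical in
lemma measurable_completeTo (i₀ : ι) :
    Measurable fun p : ℝ × ({i : ι // i ≠ i₀} → ℝ) => completeTo i₀ p.1 p.2 := by
  refine measurable_pi_lambda _ fun i => ?_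
  by_cases h : i = i₀ <;> simp only [completeTo, h, dite_true, dite_false] <;> fun_prop

lemma measurable_complete (i₀ : ι) : Measurable (complete i₀) :=
  (measurable_completeTo i₀).comp (measurable_const.prodMk measurable_id)

open scoped Classical in
lemma lintegral_eq_lintegral_completeTo (i₀ : ι) {f : (ι → ℝ) → ℝ≥0∞} (hf : Measurable f) :
    ∫⁻ y, f y = ∫⁻ s : ℝ, ∫⁻ x : {i : ι // i ≠ i₀} → ℝ, f (completeTo i₀ s x) := by
  let _ : Unique {i : ι // ¬ i ≠ i₀} :=
    ⟨⟨⟨i₀, by simp⟩⟩, fun j => Subtype.ext (not_not.1 j.2)⟩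
  let e := (MeasurableEquiv.piEquivPiSubtypeProd (fun _ : ι => ℝ) (· ≠ i₀)).symm
  let u := (MeasurableEquiv.funUnique {i : ι // ¬ i ≠ i₀} ℝ).symm
  have he := (volume_preserving_piEquivPiSubtypeProd (fun _ : ι => ℝ) (· ≠ i₀)).symm
  have hu : MeasurePreserving u :=
    (measurePreserving_piUnique fun _ : {i : ι // ¬ i ≠ i₀} => (volume : Measure ℝ)).symm
  have hcoord (x : {i : ι // i ≠ i₀} → ℝ) (s : ℝ) :
      e (x, u (s - ∑ j, x j)) = completeTo i₀ s x := by
    ext i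
    by_cases h : i = i₀ <;>
      simp [e, u, completeTo, MeasurableEquiv.piEquivPiSubtypeProd, Equiv.piEquivPiSubtypeProd, h]
  have hfe : Measurable fun p => f (e p) := hf.comp e.measurable
  rw [← he.lintegral_comp hf, Measure.volume_eq_prod, lintegral_prod _ hfe.aemeasurable,
    lintegral_lintegral_swap (f := fun s x => f (completeTo i₀ s x))
      (hf.comp (measurable_completeTo i₀)).aemeasurable]
  refine lintegral_congr fun x => ?_
  have hfx : Measurable fun y => f (e (x, y)) := hfe.comp measurable_prodMk_left
  rw [← hu.lintegral_comp hfx, ← lintegral_sub_right_eq_self _ (∑ j, x j)]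
  exact lintegral_congr fun s => congrArg f (hcoord x s)

lemma lintegral_eq_pow_mul_lintegral_smul {s : ℝ} (hs : 0 < s)
    {F : (ι → ℝ) → ℝ≥0∞} (hF : Measurable F) :
    ∫⁻ z, F z = ENNReal.ofReal (s ^ Fintype.card ι) * ∫⁻ x, F (s • x) := by
  rw [← lintegral_map hF (measurable_const_smul s), Measure.map_addHaar_smul _ hs.ne',
    lintegral_smul_measure, smul_eq_mul, ← mul_assoc, Module.finrank_fintype_fun_eq_card,
    abs_of_pos (by positivity), ← ENNReal.ofReal_mul (by positivity),
    mul_inv_cancel₀ (by positivity), ENNReal.ofReal_one, one_mul]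

lemma measurableSet_openSimplex (ι : Type*) [Fintype ι] : MeasurableSet (openSimplex ι) := by
  have hpos : MeasurableSet {x : ι → ℝ | ∀ i, 0 < x i} := by
    rw [Set.ofPred_forall]
    exact MeasurableSet.iInter fun i => measurableSet_lt measurable_const (measurable_pi_apply i)
  exact hpos.inter (measurableSet_eq_fun (by fun_prop) measurable_const)

open scoped Classical in
lemma lintegral_simplexMeasure (i₀ : ι) {f : (ι → ℝ) → ℝ≥0∞} (hf : Measurable f) :
    ∫⁻ p, f p.1 ∂simplexMeasure i₀ =
      ∫⁻ x, (openSimplex ι).indicator f (complete i₀ x) := by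
  rw [simplexMeasure, lintegral_subtype_comap (measurableSet_openSimplex ι),
    ← lintegral_indicator (measurableSet_openSimplex ι),
    lintegral_map (hf.indicator (measurableSet_openSimplex ι)) (measurable_complete i₀)]

open scoped Classical in
lemma complete_mem_openSimplex_iff (i₀ : ι) (x : {i : ι // i ≠ i₀} → ℝ) :
    complete i₀ x ∈ openSimplex ι ↔ ∀ i, 0 < complete i₀ x i :=
  ⟨And.left, fun h => ⟨h, sum_completeTo i₀ 1 x⟩⟩

open scoped Classical in
lemma lintegral_eq_lintegral_simplexMeasure (i₀ : ι) {f : (ι → ℝ) → ℝ≥0∞} (hf : Measurable f)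
    (hf0 : ∀ y, (∃ i, y i ≤ 0) → f y = 0) :
    ∫⁻ y, f y = ∫⁻ s in Set.Ioi (0 : ℝ), ENNReal.ofReal (s ^ (Fintype.card ι - 1)) *
      ∫⁻ p, f (s • p.1) ∂simplexMeasure i₀ := by
  rw [lintegral_eq_lintegral_completeTo i₀ hf, ← lintegral_indicator measurableSet_Ioi]
  refine lintegral_congr fun s => ?_
  rcases le_or_gt s 0 with hs | hs
  · rw [Set.indicator_of_notMem (s := Set.Ioi 0) (not_lt.2 hs)]
    refine (lintegral_congr fun x => hf0 _ ?_).trans lintegral_zero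
    by_contra! hpos
    exact hs.not_gt (sum_completeTo i₀ s x ▸
      Finset.sum_pos (fun i _ => hpos i) ⟨i₀, Finset.mem_univ _⟩)
  · have hfs : Measurable fun x => f (completeTo i₀ s x) :=
      hf.comp ((measurable_completeTo i₀).comp measurable_prodMk_left)
    rw [Set.indicator_of_mem (Set.mem_Ioi.2 hs), lintegral_eq_pow_mul_lintegral_smul hs hfs,
      Fintype.card_subtype_compl, Fintype.card_subtype_eq,
      lintegral_simplexMeasure i₀ (f := fun y => f (s • y)) (hf.comp (measurable_const_smul s))]
    refine congrArg _ (lintegral_congr fun x => ?_)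
    rw [completeTo_smul]
    by_cases hx : complete i₀ x ∈ openSimplex ι
    · rw [Set.indicator_of_mem hx]
    · rw [Set.indicator_of_notMem hx]
      rw [complete_mem_openSimplex_iff] at hx
      push Not at hx
      obtain ⟨i, hi⟩ := hx
      exact hf0 _ ⟨i, mul_nonpos_of_nonneg_of_nonpos hs.le hi⟩

end SumChart

section Dirichlet

variable {ι : Type*} [Fintype ι]

lemma measurable_prod_rpow (b : ι → ℝ) :
    Measurable fun p : Simplex ι => ∏ i, p.1 i ^ b i :=
  Finset.measurable_prod _ fun i _ =>
    ((measurable_pi_apply i).comp measurable_subtype_coe).pow_const _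

lemma measurable_dirichletDensity (a : ι → ℝ) : Measurable (dirichletDensity a) :=
  ((measurable_prod_rpow _).const_mul _).ennreal_ofReal

lemma prod_gammaDensity_smul [Nonempty ι] {a : ι → ℝ} (ha : ∀ i, 0 < a i) {s : ℝ} (hs : 0 < s)
    (p : Simplex ι) :
    ENNReal.ofReal (s ^ (Fintype.card ι - 1)) * ∏ i, gammaDensity (a i) ((s • p.1) i) =
      gammaDensity (∑ i, a i) s * dirichletDensity a p := by
  have hsum : 0 < ∑ i, a i := Finset.sum_pos (fun i _ => ha i) Finset.univ_nonempty
  have := Real.Gamma_pos_of_pos hsum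
  have hΓ (i : ι) : 0 < Real.Gamma (a i) := Real.Gamma_pos_of_pos (ha i)
  have hp := p.2.1
  have hfactor (i : ι) : gammaDensity (a i) ((s • p.1) i) = ENNReal.ofReal
      ((Real.Gamma (a i))⁻¹ * (s ^ (a i - 1) * p.1 i ^ (a i - 1)) * Real.exp (-s * p.1 i)) := by
    rw [Pi.smul_apply, smul_eq_mul, gammaDensity_of_pos _ (mul_pos hs (hp i)),
      Real.mul_rpow hs.le (hp i).le, neg_mul]
  have hexp : ∏ i, Real.exp (-s * p.1 i) = Real.exp (-s) := by
    rw [← Real.exp_sum, ← Finset.mul_sum, p.2.2, mul_one]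
  have hpow : s ^ (Fintype.card ι - 1) * ∏ i, s ^ (a i - 1) = s ^ (∑ i, a i - 1) := by
    rw [← Real.rpow_sum_of_pos hs, ← Real.rpow_natCast, ← Real.rpow_add hs,
      Finset.sum_sub_distrib]
    push_cast [Fintype.card_pos (α := ι)]
    simp
  have hnn (i : ι) : 0 ≤ (Real.Gamma (a i))⁻¹ * (s ^ (a i - 1) * p.1 i ^ (a i - 1)) *
      Real.exp (-s * p.1 i) := by
    have := hp i
    have := hΓ i
    positivity
  rw [Finset.prod_congr rfl fun i _ => hfactor i, gammaDensity_of_pos _ hs, dirichletDensity,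
    ← ENNReal.ofReal_prod_of_nonneg fun i _ => hnn i, ← ENNReal.ofReal_mul (by positivity),
    ← ENNReal.ofReal_mul (by positivity), ← hpow]
  simp only [Finset.prod_mul_distrib, Finset.prod_inv_distrib, hexp]
  field_simp

lemma lintegral_dirichletDensity (i₀ : ι) {a : ι → ℝ} (ha : ∀ i, 0 < a i) :
    ∫⁻ p, dirichletDensity a p ∂simplexMeasure i₀ = 1 := by
  have : Nonempty ι := ⟨i₀⟩
  have hsum : 0 < ∑ i, a i := Finset.sum_pos (fun i _ => ha i) Finset.univ_nonempty
  have hIoi : ∫⁻ s in Set.Ioi 0, gammaDensity (∑ i, a i) s = 1 :=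
    (setLIntegral_eq_of_support_subset Set.support_indicator_subset).trans
      (lintegral_gammaDensity hsum)
  have hf : Measurable fun y : ι → ℝ => ∏ i, gammaDensity (a i) (y i) :=
    Finset.measurable_prod _ fun i _ =>
      (measurable_gammaDensity (a i)).comp (measurable_pi_apply i)
  have hf0 (y : ι → ℝ) : (∃ i, y i ≤ 0) → ∏ i, gammaDensity (a i) (y i) = 0 :=
    fun ⟨i, hi⟩ => Finset.prod_eq_zero (Finset.mem_univ i) (gammaDensity_of_nonpos _ hi)
  calc ∫⁻ p, dirichletDensity a p ∂simplexMeasure i₀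
      = ∫⁻ s in Set.Ioi 0, gammaDensity (∑ i, a i) s *
          ∫⁻ p, dirichletDensity a p ∂simplexMeasure i₀ := by
        rw [lintegral_mul_const _ (measurable_gammaDensity _), hIoi, one_mul]
    _ = ∫⁻ y : ι → ℝ, ∏ i, gammaDensity (a i) (y i) := by
        rw [lintegral_eq_lintegral_simplexMeasure i₀ hf hf0]
        refine setLIntegral_congr_fun measurableSet_Ioi fun s hs => ?_
        rw [← lintegral_const_mul _ (measurable_dirichletDensity a),
          ← lintegral_const_mul' _ _ ENNReal.ofReal_ne_top]
        exact lintegral_congr fun p => (prod_gammaDensity_smul ha hs p).symm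
    _ = 1 := by
        rw [volume_pi, lintegral_pi_prod _ fun i => measurable_gammaDensity (a i),
          Finset.prod_eq_one fun i _ => lintegral_gammaDensity (ha i)]

variable [Nonempty ι]

lemma isProbabilityMeasure_dirichlet {a : ι → ℝ} (ha : ∀ i, 0 < a i) :
    IsProbabilityMeasure (dirichlet a) where
  measure_univ := by
    rw [dirichlet, dif_pos ‹_›, withDensity_apply _ MeasurableSet.univ, Measure.restrict_univ,
      lintegral_dirichletDensity _ ha]

lemma dirichletDensity_mul_prod_rpow {a b : ι → ℝ} (ha : ∀ i, 0 < a i) (hb : ∀ i, 0 < b i)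
    (p : Simplex ι) :
    dirichletDensity a p * ENNReal.ofReal (∏ i, p.1 i ^ (b i - a i)) =
      ENNReal.ofReal (Real.Gamma (∑ i, a i) / (∏ i, Real.Gamma (a i)) *
        ((∏ i, Real.Gamma (b i)) / Real.Gamma (∑ i, b i))) * dirichletDensity b p := by
  have hΓ {c : ι → ℝ} (hc : ∀ i, 0 < c i) : 0 < Real.Gamma (∑ i, c i) :=
    Real.Gamma_pos_of_pos (Finset.sum_pos (fun i _ => hc i) Finset.univ_nonempty)
  have hΓ' {c : ι → ℝ} (hc : ∀ i, 0 < c i) : 0 < ∏ i, Real.Gamma (c i) :=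
    Finset.prod_pos fun i _ => Real.Gamma_pos_of_pos (hc i)
  have := hΓ ha
  have := hΓ hb
  have := hΓ' ha
  have := hΓ' hb
  have hprod (c : ι → ℝ) : 0 ≤ ∏ i, p.1 i ^ c i :=
    Finset.prod_nonneg fun i _ => Real.rpow_nonneg (p.2.1 i).le _
  have hpow : ∏ i, p.1 i ^ (b i - 1) =
      (∏ i, p.1 i ^ (a i - 1)) * ∏ i, p.1 i ^ (b i - a i) := by
    rw [← Finset.prod_mul_distrib]
    refine Finset.prod_congr rfl fun i _ => ?_
    rw [← Real.rpow_add (p.2.1 i)]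
    ring_nf
  rw [dirichletDensity, dirichletDensity,
    ← ENNReal.ofReal_mul (mul_nonneg (by positivity) (hprod _)),
    ← ENNReal.ofReal_mul (by positivity), hpow]
  field_simp

lemma lintegral_dirichlet_prod_rpow {a b : ι → ℝ} (ha : ∀ i, 0 < a i) (hb : ∀ i, 0 < b i) :
    ∫⁻ p, ENNReal.ofReal (∏ i, p.1 i ^ (b i - a i)) ∂dirichlet a =
      ENNReal.ofReal (Real.Gamma (∑ i, a i) / (∏ i, Real.Gamma (a i)) *
        ((∏ i, Real.Gamma (b i)) / Real.Gamma (∑ i, b i))) := by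
  rw [dirichlet, dif_pos ‹_›, lintegral_withDensity_eq_lintegral_mul _
    (measurable_dirichletDensity a) (measurable_prod_rpow _).ennreal_ofReal]
  simp only [Pi.mul_apply, dirichletDensity_mul_prod_rpow ha hb]
  rw [lintegral_const_mul _ (measurable_dirichletDensity b), lintegral_dirichletDensity _ hb,
    mul_one]

lemma Gamma_le_inv {ε : ℝ} (hε : ε ∈ Set.Ioc (0 : ℝ) 1) : Real.Gamma ε ≤ ε⁻¹ := by
  have hconv := Real.convexOn_Gamma.2 (Set.mem_Ioi.2 one_pos) (Set.mem_Ioi.2 two_pos)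
    (sub_nonneg.2 hε.2) hε.1.le (by ring)
  rw [show (1 - ε) • (1 : ℝ) + ε • 2 = ε + 1 by simp only [smul_eq_mul]; ring,
    Real.Gamma_add_one hε.1.ne', Real.Gamma_one, Real.Gamma_two] at hconv
  rw [← one_div, le_div_iff₀ hε.1]
  simpa [mul_comm] using hconv

lemma continuous_inv_Gamma : Continuous fun x : ℝ => (Real.Gamma x)⁻¹ := by
  refine (Complex.continuous_re.comp
    (Complex.differentiable_one_div_Gamma.continuous.comp Complex.continuous_ofReal)).congr
    fun x => ?_
  simp [Complex.Gamma_ofReal, ← Complex.ofReal_inv]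

lemma exists_lintegral_dirichlet_le {a : ι → ℝ} (ha : ∀ i, 0 < a i) :
    ∃ C : ℝ, 0 < C ∧ ∀ ε ∈ Set.Ioc (0 : ℝ) 1,
      ∫⁻ p, ENNReal.ofReal (∏ i, p.1 i ^ (ε - a i)) ∂dirichlet a ≤
        ENNReal.ofReal (C * ε⁻¹ ^ Fintype.card ι) := by
  obtain ⟨M, hM⟩ := isCompact_Icc.bddAbove_image
    (continuous_inv_Gamma.continuousOn (s := Set.Icc 0 (Fintype.card ι : ℝ)))
  have hΓ : 0 < Real.Gamma (∑ i, a i) :=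
    Real.Gamma_pos_of_pos (Finset.sum_pos (fun i _ => ha i) Finset.univ_nonempty)
  have hΓ' : 0 < ∏ i, Real.Gamma (a i) :=
    Finset.prod_pos fun i _ => Real.Gamma_pos_of_pos (ha i)
  refine ⟨Real.Gamma (∑ i, a i) / (∏ i, Real.Gamma (a i)) * max M 1, by positivity,
    fun ε hε => ?_⟩
  have hcard : (0 : ℝ) ≤ Fintype.card ι := Nat.cast_nonneg _
  have hinv : (Real.Gamma (Fintype.card ι * ε))⁻¹ ≤ max M 1 :=
    (hM ⟨_, ⟨mul_nonneg hcard hε.1.le, mul_le_of_le_one_right hcard hε.2⟩, rfl⟩).trans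
      (le_max_left _ _)
  rw [lintegral_dirichlet_prod_rpow ha fun _ => hε.1, mul_assoc (_ / _)]
  gcongr
  rw [Finset.prod_const, Finset.sum_const, Finset.card_univ, nsmul_eq_mul, div_eq_inv_mul]
  exact mul_le_mul hinv (pow_le_pow_left₀ (Real.Gamma_pos_of_pos hε.1).le (Gamma_le_inv hε) _)
    (pow_nonneg (Real.Gamma_pos_of_pos hε.1).le _) (by positivity)

end Dirichlet

section ProductEnvironment

variable {ι : Type*} [Fintype ι] {D : ι → Type*} [∀ x, Fintype (D x)]

/-- The monomial `∏ₑ ω(e) ^ b(e)` in the exit probabilities of an environment on finitely many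
sites, where `D x` is the set of exits of `x` and an edge is a site with one of its exits. -/
noncomputable def envMonomial (b : (Σ x, D x) → ℝ) (ω : ∀ x, Simplex (D x)) : ℝ≥0∞ :=
  ENNReal.ofReal (∏ e, (ω e.1).1 e.2 ^ b e)

lemma envMonomial_eq_prod (b : (Σ x, D x) → ℝ) (ω : ∀ x, Simplex (D x)) :
    envMonomial b ω = ∏ x, ENNReal.ofReal (∏ i, (ω x).1 i ^ b ⟨x, i⟩) := by
  rw [envMonomial, Fintype.prod_sigma, ENNReal.ofReal_prod_of_nonneg]
  exact fun x _ => Finset.prod_nonneg fun i _ => Real.rpow_nonneg ((ω x).2.1 i).le _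

lemma measurable_envMonomial (b : (Σ x, D x) → ℝ) : Measurable (envMonomial b) := by
  simp only [funext (envMonomial_eq_prod b)]
  exact Finset.measurable_prod _ fun x _ =>
    (measurable_prod_rpow _).ennreal_ofReal.comp (measurable_pi_apply x)

lemma exists_lintegral_envMonomial_le [∀ x, Nonempty (D x)] {α : ∀ x, D x → ℝ}
    (hα : ∀ x i, 0 < α x i) :
    ∃ C : ℝ, 0 < C ∧ ∀ ε ∈ Set.Ioc (0 : ℝ) 1,
      ∫⁻ ω, envMonomial (fun e => ε - α e.1 e.2) ω ∂Measure.pi (fun x => dirichlet (α x)) ≤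
        ENNReal.ofReal (C * ε⁻¹ ^ Fintype.card (Σ x, D x)) := by
  have (x : ι) : IsProbabilityMeasure (dirichlet (α x)) := isProbabilityMeasure_dirichlet (hα x)
  choose C hC hle using fun x => exists_lintegral_dirichlet_le (hα x)
  refine ⟨∏ x, C x, Finset.prod_pos fun x _ => hC x, fun ε hε => ?_⟩
  have hε0 : 0 < ε := hε.1
  simp only [envMonomial_eq_prod]
  rw [lintegral_pi_prod _ fun x => (measurable_prod_rpow fun i => ε - α x i).ennreal_ofReal]
  calc ∏ x, ∫⁻ p, ENNReal.ofReal (∏ i, p.1 i ^ (ε - α x i)) ∂dirichlet (α x)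
      ≤ ∏ x, ENNReal.ofReal (C x * ε⁻¹ ^ Fintype.card (D x)) :=
        Finset.prod_le_prod' fun x _ => hle x ε hε
    _ = ENNReal.ofReal ((∏ x, C x) * ε⁻¹ ^ Fintype.card (Σ x, D x)) := by
        rw [← ENNReal.ofReal_prod_of_nonneg fun x _ => by have := hC x; positivity,
          Finset.prod_mul_distrib, Finset.prod_pow_eq_pow_sum, Fintype.card_sigma]

end ProductEnvironment

section Tail

lemma eventually_lt_sub_mul {s β : ℝ} (h : s < β) (m : ℝ) :
    ∀ᶠ ε in nhdsWithin (0 : ℝ) (Set.Ioi 0), s < β - m * ε := by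
  have : Tendsto (fun ε : ℝ => β - m * ε) (nhds 0) (nhds (β - m * 0)) :=
    Continuous.tendsto (by fun_prop) 0
  exact nhdsWithin_le_nhds (this.eventually_const_lt (by simpa using h))

lemma rpow_sub_div_log {t : ℝ} (ht : 1 < t) (β c : ℝ) :
    t ^ (β - c * (Real.log t)⁻¹) = t ^ β * Real.exp (-c) := by
  have ht0 : 0 < t := one_pos.trans ht
  rw [sub_eq_add_neg, Real.rpow_add ht0, Real.rpow_def_of_pos ht0 (-_)]
  congr 2
  field_simp [(Real.log_pos ht).ne']

/-- Markov's inequality with the moment of order `β - m / log t`. -/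
lemma eventually_measure_lt_le {Ω : Type*} [MeasurableSpace Ω] {μ : Measure Ω} {f : Ω → ℝ≥0∞}
    (hf : AEMeasurable f μ) {β C : ℝ} {m : ℕ} (hβ : 0 < β)
    (hmoment : ∀ᶠ ε in nhdsWithin (0 : ℝ) (Set.Ioi 0),
      ∫⁻ ω, f ω ^ (β - m * ε) ∂μ ≤ ENNReal.ofReal (C * ε⁻¹ ^ m)) :
    ∀ᶠ t : ℝ in atTop, μ {ω | ENNReal.ofReal t < f ω} ≤
      ENNReal.ofReal (C * Real.exp m * Real.log t ^ (m : ℝ) / t ^ β) := by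
  have hlog : Tendsto (fun t => (Real.log t)⁻¹) atTop (nhdsWithin (0 : ℝ) (Set.Ioi 0)) :=
    tendsto_inv_atTop_nhdsGT_zero.comp Real.tendsto_log_atTop
  filter_upwards [hlog.eventually hmoment, hlog.eventually (eventually_lt_sub_mul hβ m),
    eventually_gt_atTop 1] with t hint hs ht
  have ht0 : 0 < t := one_pos.trans ht
  have hlt (ω : Ω) (hω : ENNReal.ofReal t < f ω) :
      ENNReal.ofReal (t ^ (β - m * (Real.log t)⁻¹)) ≤
        f ω ^ (β - m * (Real.log t)⁻¹) := by
    rw [← ENNReal.ofReal_rpow_of_pos ht0]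
    exact ENNReal.rpow_le_rpow hω.le hs.le
  have hpow : 0 < t ^ (β - m * (Real.log t)⁻¹) := Real.rpow_pos_of_pos ht0 _
  calc μ {ω | ENNReal.ofReal t < f ω}
      ≤ (∫⁻ ω, f ω ^ (β - m * (Real.log t)⁻¹) ∂μ) /
          ENNReal.ofReal (t ^ (β - m * (Real.log t)⁻¹)) :=
        (measure_mono hlt).trans (meas_ge_le_lintegral_div (hf.pow_const _)
          (ENNReal.ofReal_pos.2 hpow).ne' ENNReal.ofReal_ne_top)
    _ ≤ ENNReal.ofReal (C * Real.log t ^ m / t ^ (β - m * (Real.log t)⁻¹)) := by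
        rw [ENNReal.ofReal_div_of_pos hpow]
        exact ENNReal.div_le_div_right (by simpa using hint) _
    _ = ENNReal.ofReal (C * Real.exp m * Real.log t ^ (m : ℝ) / t ^ β) := by
        rw [rpow_sub_div_log ht, Real.exp_neg, Real.rpow_natCast]
        field_simp

end Tail

section LengthWidth

/-- Directed multigraphs: edges are abstract, so that the exits of a site may be labelled by
directions as well as by their heads. -/
structure DirectedMultigraph (V E : Type*) where
  src : E → V
  tgt : E → V

namespace DirectedMultigraph

variable {V E : Type*} (Γ : DirectedMultigraph V E) {o v : V} {p : List E} {e : E}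

/-- The edges `p`, in this order, form a path from `o` to `v` that visits no vertex twice. -/
def IsSimplePath (o : V) (p : List E) (v : V) : Prop :=
  p.map Γ.src ++ [v] = o :: p.map Γ.tgt ∧ (o :: p.map Γ.tgt).Nodup

/-- The vertices that simple paths from `o` reach within total length `r`, where the edge `e` has
length `ℓ e`. -/
def reach (ℓ : E → ℝ) (o : V) (r : ℝ) : Set V :=
  {v | ∃ p, Γ.IsSimplePath o p v ∧ (p.map ℓ).sum ≤ r}

/-- Some edge goes from `a` to `b` inside `U`. -/
def Joins (U : Set V) (a b : V) : Prop :=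
  a ∈ U ∧ b ∈ U ∧ ∃ e, Γ.src e = a ∧ Γ.tgt e = b

/-- `U` contains an edge that exits `o`, and each of its points is reached from `o` inside `U`. -/
def IsCluster (o : V) (U : Set V) : Prop :=
  o ∈ U ∧ (∃ e, Γ.src e = o ∧ Γ.tgt e ∈ U) ∧ ∀ v ∈ U, Relation.ReflTransGen (Γ.Joins U) o v

open scoped Classical in
/-- The total weight of the edges that exit `U`. -/
noncomputable def cutWeight [Fintype E] (a : E → ℝ) (U : Set V) : ℝ :=
  ∑ e with Γ.src e ∈ U ∧ Γ.tgt e ∉ U, a e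

variable {Γ}

lemma isSimplePath_nil : Γ.IsSimplePath o [] v ↔ v = o := by
  simp [IsSimplePath]

lemma isSimplePath_cons :
    Γ.IsSimplePath o (e :: p) v ↔
      Γ.src e = o ∧ o ∉ Γ.tgt e :: p.map Γ.tgt ∧ Γ.IsSimplePath (Γ.tgt e) p v := by
  simp only [IsSimplePath, List.map_cons, List.cons_append, List.cons.injEq,
    List.nodup_cons (a := o)]
  tauto

lemma isSimplePath_concat :
    Γ.IsSimplePath o (p ++ [e]) v ↔
      Γ.IsSimplePath o p (Γ.src e) ∧ v = Γ.tgt e ∧ Γ.tgt e ∉ o :: p.map Γ.tgt := by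
  have hnodup : (o :: p.map Γ.tgt ++ [Γ.tgt e]).Nodup ↔
      (o :: p.map Γ.tgt).Nodup ∧ Γ.tgt e ∉ o :: p.map Γ.tgt := by
    rw [← List.concat_eq_append, List.nodup_concat, and_comm]
  simp only [IsSimplePath, List.map_append, List.map_singleton, ← List.cons_append, hnodup,
    List.append_singleton_inj]
  tauto

variable {ℓ : E → ℝ}

lemma monotone_reach : Monotone (Γ.reach ℓ o) :=
  fun _ _ h _ ⟨p, hp, hr⟩ => ⟨p, hp, hr.trans h⟩

lemma self_mem_reach {r : ℝ} (hr : 0 ≤ r) : o ∈ Γ.reach ℓ o r :=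
  ⟨[], isSimplePath_nil.2 rfl, by simpa using hr⟩

lemma IsSimplePath.mem_reach (hℓ : ∀ e, 0 ≤ ℓ e) (hp : Γ.IsSimplePath o p v) {w : V}
    (hw : w ∈ o :: p.map Γ.tgt) : w ∈ Γ.reach ℓ o (p.map ℓ).sum := by
  induction p using List.reverseRecOn generalizing v with
  | nil =>
    obtain rfl : w = o := by simpa using hw
    exact self_mem_reach le_rfl
  | append_singleton q e ih =>
    rw [List.map_append, ← List.cons_append, List.mem_append, List.map_singleton,
      List.mem_singleton] at hw
    rcases hw with hw | rfl
    · refine monotone_reach ?_ (ih (isSimplePath_concat.1 hp).1 hw)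
      simpa using hℓ e
    · exact ⟨q ++ [e], (isSimplePath_concat.1 hp).2.1 ▸ hp, le_rfl⟩

lemma tgt_mem_reach (hℓ : ∀ e, 0 ≤ ℓ e) {r : ℝ} (h : Γ.src e ∈ Γ.reach ℓ o r) :
    Γ.tgt e ∈ Γ.reach ℓ o (r + ℓ e) := by
  obtain ⟨p, hp, hr⟩ := h
  by_cases he : Γ.tgt e ∈ o :: p.map Γ.tgt
  · exact monotone_reach (hr.trans (le_add_of_nonneg_right (hℓ e))) (hp.mem_reach hℓ he)
  · exact ⟨p ++ [e], isSimplePath_concat.2 ⟨hp, rfl, he⟩, by simpa using hr⟩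

lemma reflTransGen_joins_reach (hℓ : ∀ e, 0 ≤ ℓ e) {r : ℝ} (hv : v ∈ Γ.reach ℓ o r) :
    Relation.ReflTransGen (Γ.Joins (Γ.reach ℓ o r)) o v := by
  obtain ⟨p, hp, hr⟩ := hv
  induction p using List.reverseRecOn generalizing v with
  | nil => rw [isSimplePath_nil.1 hp]
  | append_singleton q e ih =>
    obtain ⟨hq, rfl, -⟩ := isSimplePath_concat.1 hp
    have hqr : (q.map ℓ).sum ≤ r := by
      have : 0 ≤ ℓ e := hℓ e
      simp only [List.map_append, List.sum_append, List.map_singleton, List.sum_singleton] at hr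
      linarith
    exact (ih hq hqr).tail ⟨⟨q, hq, hqr⟩, ⟨q ++ [e], hp, hr⟩, e, rfl, rfl⟩

lemma isCluster_reach (hℓ : ∀ e, 0 ≤ ℓ e) {r : ℝ} (hr : ℓ e ≤ r) :
    Γ.IsCluster (Γ.src e) (Γ.reach ℓ (Γ.src e) r) := by
  refine ⟨self_mem_reach ((hℓ e).trans hr), ⟨e, rfl, ?_⟩, fun v => reflTransGen_joins_reach hℓ⟩
  refine monotone_reach ?_ (tgt_mem_reach hℓ (self_mem_reach le_rfl))
  rwa [zero_add]

lemma measurableSet_setOf_mem {U : ℝ → Set V} (hU : Monotone U) (v : V) :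
    MeasurableSet {r | v ∈ U r} :=
  (IsUpperSet.ordConnected fun _ _ h hr => hU h hr).measurableSet

lemma volume_setOf_cut_le {U : ℝ → Set V} (hU : Monotone U)
    (hstep : ∀ r, Γ.src e ∈ U r → Γ.tgt e ∈ U (r + ℓ e)) :
    volume {r | Γ.src e ∈ U r ∧ Γ.tgt e ∉ U r} ≤ ENNReal.ofReal (ℓ e) := by
  have hsub {r r' : ℝ} (hr : Γ.src e ∈ U r) (hr' : Γ.tgt e ∉ U r') : r' - r ≤ ℓ e := by
    by_contra! h
    exact hr' (hU (by linarith) (hstep r hr))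
  refine (Real.volume_le_diam _).trans (Metric.ediam_le fun r hr r' hr' => ?_)
  rw [edist_dist, Real.dist_eq]
  exact ENNReal.ofReal_le_ofReal (abs_sub_le_iff.2 ⟨hsub hr'.1 hr.2, hsub hr.1 hr'.2⟩)

open scoped Classical in
/-- The length–width inequality: integrate the weights of the cuts `U r` over `r`, and note that
an edge belongs to the cut during at most its length. -/
lemma mul_le_sum_of_le_cutWeight [Fintype E] {a : E → ℝ} (ha : ∀ e, 0 ≤ a e) (hℓ : ∀ e, 0 ≤ ℓ e)
    {U : ℝ → Set V} (hU : Monotone U)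
    (hstep : ∀ e r, Γ.src e ∈ U r → Γ.tgt e ∈ U (r + ℓ e)) {s c T : ℝ} (hs : 0 ≤ s)
    (hcut : ∀ r ∈ Set.Ico c T, s ≤ Γ.cutWeight a (U r)) :
    s * (T - c) ≤ ∑ e, a e * ℓ e := by
  let cut (e : E) : Set ℝ := {r | Γ.src e ∈ U r ∧ Γ.tgt e ∉ U r}
  have hmeas (e : E) : MeasurableSet (cut e) :=
    (measurableSet_setOf_mem hU _).inter (measurableSet_setOf_mem hU _).compl
  have hweight (r : ℝ) : ENNReal.ofReal (Γ.cutWeight a (U r)) =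
      ∑ e, (cut e).indicator (fun _ => ENNReal.ofReal (a e)) r := by
    rw [cutWeight, ENNReal.ofReal_sum_of_nonneg fun e _ => ha e, Finset.sum_filter]
    exact Finset.sum_congr rfl fun e _ => by simp only [cut, Set.indicator_apply]; rfl
  rw [← ENNReal.ofReal_le_ofReal_iff (Finset.sum_nonneg fun e _ => mul_nonneg (ha e) (hℓ e))]
  calc ENNReal.ofReal (s * (T - c)) = ∫⁻ _ in Set.Ico c T, ENNReal.ofReal s := by
        rw [setLIntegral_const, Real.volume_Ico, ENNReal.ofReal_mul hs]
    _ ≤ ∫⁻ r in Set.Ico c T, ENNReal.ofReal (Γ.cutWeight a (U r)) :=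
        setLIntegral_mono' measurableSet_Ico fun r hr => ENNReal.ofReal_le_ofReal (hcut r hr)
    _ ≤ ∫⁻ r, ∑ e, (cut e).indicator (fun _ => ENNReal.ofReal (a e)) r := by
        simp only [hweight]
        exact setLIntegral_le_lintegral _ _
    _ = ∑ e, ENNReal.ofReal (a e) * volume (cut e) := by
        rw [lintegral_finsetSum _ fun e _ => measurable_const.indicator (hmeas e)]
        exact Finset.sum_congr rfl fun e _ => lintegral_indicator_const (hmeas e) _
    _ ≤ ∑ e, ENNReal.ofReal (a e) * ENNReal.ofReal (ℓ e) := by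
        gcongr with e
        exact volume_setOf_cut_le hU (hstep e)
    _ = ENNReal.ofReal (∑ e, a e * ℓ e) := by
        rw [ENNReal.ofReal_sum_of_nonneg fun e _ => mul_nonneg (ha e) (hℓ e)]
        exact Finset.sum_congr rfl fun e _ => (ENNReal.ofReal_mul (ha e)).symm

lemma exists_isSimplePath_sum_le [Fintype E] {a : E → ℝ} (ha : ∀ e, 0 ≤ a e)
    (hℓ : ∀ e, 0 ≤ ℓ e) {X : Set V} {s T : ℝ} (hs : 0 ≤ s)
    (hcut : ∀ U, Γ.IsCluster (Γ.src e) U → Disjoint U X → s ≤ Γ.cutWeight a U)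
    (hT : ∑ e, a e * ℓ e < s * (T - ℓ e)) :
    ∃ p, ∃ v ∈ X, Γ.IsSimplePath (Γ.src e) p v ∧ (p.map ℓ).sum ≤ T := by
  by_contra! hno
  refine hT.not_ge (mul_le_sum_of_le_cutWeight ha hℓ (monotone_reach (o := Γ.src e))
    (fun e r => tgt_mem_reach hℓ) hs fun r hr => hcut _ (isCluster_reach hℓ hr.1) ?_)
  rw [Set.disjoint_left]
  rintro v ⟨p, hp, hpr⟩ hv
  exact (hno p v hv hp).not_ge (hpr.trans hr.2.le)

end DirectedMultigraph

end LengthWidth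

section PathProbability

lemma exists_inv_card_le {ι : Type*} [Fintype ι] [Nonempty ι] (p : Simplex ι) :
    ∃ i, (Fintype.card ι : ℝ)⁻¹ ≤ p.1 i := by
  obtain ⟨i, -, hi⟩ := Finset.exists_le_of_sum_le (s := Finset.univ)
    (f := fun _ : ι => (Fintype.card ι : ℝ)⁻¹) (g := p.1) Finset.univ_nonempty (by simp [p.2.2])
  exact ⟨i, hi⟩

lemma simplex_le_one {ι : Type*} [Fintype ι] (p : Simplex ι) (i : ι) : p.1 i ≤ 1 :=
  (Finset.single_le_sum (fun j _ => (p.2.1 j).le) (Finset.mem_univ i)).trans_eq p.2.2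

variable {ι : Type*} {D : ι → Type*} [∀ x, Fintype (D x)]

/-- The probability that the walk in the environment `ω` takes the edges `p` one after the
other. -/
def pathProb (ω : ∀ x, Simplex (D x)) (p : List (Σ x, D x)) : ℝ :=
  (p.map fun e => (ω e.1).1 e.2).prod

lemma pathProb_cons (ω : ∀ x, Simplex (D x)) (e : Σ x, D x) (p : List (Σ x, D x)) :
    pathProb ω (e :: p) = (ω e.1).1 e.2 * pathProb ω p := by
  simp [pathProb]

lemma pathProb_eq_exp (ω : ∀ x, Simplex (D x)) (p : List (Σ x, D x)) :
    pathProb ω p = Real.exp (-(p.map fun e => -Real.log ((ω e.1).1 e.2)).sum) := by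
  induction p with
  | nil => simp [pathProb]
  | cons e p ih =>
    rw [pathProb_cons, List.map_cons, List.sum_cons, neg_add, Real.exp_add, ← ih, neg_neg,
      Real.exp_log ((ω e.1).2.1 e.2)]

lemma measurable_pathProb (p : List (Σ x, D x)) :
    Measurable fun ω : ∀ x, Simplex (D x) => pathProb ω p := by
  induction p with
  | nil => exact measurable_const
  | cons e p ih =>
    have he : Measurable fun ω : ∀ x, Simplex (D x) => (ω e.1).1 e.2 :=
      (measurable_pi_apply e.2).comp (measurable_subtype_coe.comp (measurable_pi_apply e.1))
    simp only [pathProb_cons]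
    exact he.mul ih

namespace DirectedMultigraph

variable {V : Type*} (Γ : DirectedMultigraph V (Σ x, D x)) {o : V} {X : Set V}

/-- The largest probability, in the environment `ω`, of a simple path from `o` to `X`. -/
noncomputable def maxPathProb (o : V) (X : Set V) (ω : ∀ x, Simplex (D x)) : ℝ≥0∞ :=
  ⨆ (p : List (Σ x, D x)) (_ : ∃ v ∈ X, Γ.IsSimplePath o p v), ENNReal.ofReal (pathProb ω p)

variable {Γ}

lemma measurable_maxPathProb [Finite ι] : Measurable (Γ.maxPathProb o X) :=
  .iSup fun p => .iSup fun _ => (measurable_pathProb p).ennreal_ofReal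

variable {x : ι}

lemma ofReal_exp_neg_le_maxPathProb [Fintype ι] [Nonempty (D x)] (hsrc : ∀ i, Γ.src ⟨x, i⟩ = o)
    {a : (Σ x, D x) → ℝ} (ha : ∀ e, 0 ≤ a e) {s : ℝ} (hs : 0 < s)
    (hcut : ∀ U, Γ.IsCluster o U → Disjoint U X → s ≤ Γ.cutWeight a U)
    (ω : ∀ x, Simplex (D x)) :
    ENNReal.ofReal (Real.exp (-(Real.log (Fintype.card (D x)) +
      (∑ e, a e * -Real.log ((ω e.1).1 e.2)) / s))) ≤ Γ.maxPathProb o X ω := by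
  let ℓ (e : Σ x, D x) : ℝ := -Real.log ((ω e.1).1 e.2)
  have hℓ (e : Σ x, D x) : 0 ≤ ℓ e :=
    neg_nonneg.2 (Real.log_nonpos ((ω e.1).2.1 e.2).le (simplex_le_one _ _))
  obtain ⟨i, hi⟩ := exists_inv_card_le (ω x)
  have hℓi : ℓ ⟨x, i⟩ ≤ Real.log (Fintype.card (D x)) := by
    have := Real.log_le_log (by positivity) hi
    rw [Real.log_inv] at this
    exact neg_le.1 this
  have hpath {T : ℝ} (hT : Real.log (Fintype.card (D x)) + (∑ e, a e * ℓ e) / s < T) :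
      ENNReal.ofReal (Real.exp (-T)) ≤ Γ.maxPathProb o X ω := by
    obtain ⟨p, v, hv, hp, hpT⟩ := exists_isSimplePath_sum_le (e := ⟨x, i⟩) (X := X) (T := T)
      ha hℓ hs.le (hsrc i ▸ hcut) (by
        rw [← div_lt_iff₀' hs]
        linarith)
    refine le_iSup₂_of_le p ⟨v, hv, hsrc i ▸ hp⟩ (ENNReal.ofReal_le_ofReal ?_)
    rw [pathProb_eq_exp]
    gcongr
  have hcont : Continuous fun T : ℝ => ENNReal.ofReal (Real.exp (-T)) :=
    ENNReal.continuous_ofReal.comp (by fun_prop)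
  exact le_of_tendsto (hcont.continuousWithinAt (s := Set.Ioi _))
    (eventually_nhdsWithin_of_forall fun T => hpath)

lemma inv_maxPathProb_rpow_le [Fintype ι] [Nonempty (D x)] (hsrc : ∀ i, Γ.src ⟨x, i⟩ = o)
    {a : (Σ x, D x) → ℝ} (ha : ∀ e, 0 ≤ a e) {s : ℝ} (hs : 0 < s)
    (hcut : ∀ U, Γ.IsCluster o U → Disjoint U X → s ≤ Γ.cutWeight a U)
    (ω : ∀ x, Simplex (D x)) :
    (Γ.maxPathProb o X ω)⁻¹ ^ s ≤
      ENNReal.ofReal ((Fintype.card (D x) : ℝ) ^ s) * envMonomial (fun e => -a e) ω := by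
  have hcard : (0 : ℝ) < Fintype.card (D x) := by exact_mod_cast Fintype.card_pos
  have hmonomial : ∏ e, (ω e.1).1 e.2 ^ (-a e) =
      Real.exp (∑ e, a e * -Real.log ((ω e.1).1 e.2)) := by
    rw [Real.exp_sum]
    refine Finset.prod_congr rfl fun e _ => ?_
    rw [Real.rpow_def_of_pos ((ω e.1).2.1 e.2)]
    ring_nf
  calc (Γ.maxPathProb o X ω)⁻¹ ^ s
      ≤ (ENNReal.ofReal (Real.exp (-(Real.log (Fintype.card (D x)) +
          (∑ e, a e * -Real.log ((ω e.1).1 e.2)) / s))))⁻¹ ^ s := by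
        gcongr
        exact ofReal_exp_neg_le_maxPathProb hsrc ha hs hcut ω
    _ = _ := by
        rw [← ENNReal.ofReal_inv_of_pos (Real.exp_pos _), ← Real.exp_neg, neg_neg,
          ENNReal.ofReal_rpow_of_pos (Real.exp_pos _), ← Real.exp_mul, add_mul,
          div_mul_cancel₀ _ hs.ne', Real.exp_add, ← Real.rpow_def_of_pos hcard, ← hmonomial,
          ENNReal.ofReal_mul (by positivity), envMonomial]

lemma inv_maxPathProb_le_card [Finite ι] [Nonempty (D x)] (hsrc : ∀ i, Γ.src ⟨x, i⟩ = o)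
    (hcut : ∀ U, Γ.IsCluster o U → ¬ Disjoint U X) (ω : ∀ x, Simplex (D x)) :
    (Γ.maxPathProb o X ω)⁻¹ ≤ Fintype.card (D x) := by
  have := Fintype.ofFinite ι
  simpa [envMonomial] using inv_maxPathProb_rpow_le hsrc (a := 0) (fun _ => le_rfl) one_pos
    (fun U hU hUX => (hcut U hU hUX).elim) ω

lemma cutWeight_sub_le_cutWeight [Fintype ι] (a : (Σ x, D x) → ℝ) (U : Set V) {ε : ℝ} (hε : 0 ≤ ε) :
    Γ.cutWeight a U - Fintype.card (Σ x, D x) * ε ≤ Γ.cutWeight (fun e => a e - ε) U := by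
  classical
  rw [cutWeight, cutWeight, Finset.sum_sub_distrib, Finset.sum_const, nsmul_eq_mul]
  gcongr
  exact Finset.card_le_univ _

lemma exists_lintegral_inv_maxPathProb_rpow_le [Fintype ι] [∀ x, Nonempty (D x)]
    (hsrc : ∀ i, Γ.src ⟨x, i⟩ = o) {α : ∀ x, D x → ℝ} (hα : ∀ x i, 0 < α x i) {β : ℝ}
    (hcut : ∀ U, Γ.IsCluster o U → Disjoint U X → β ≤ Γ.cutWeight (fun e => α e.1 e.2) U) :
    ∃ C : ℝ, 0 < C ∧ ∀ᶠ ε in nhdsWithin (0 : ℝ) (Set.Ioi 0),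
      ∀ s ∈ Set.Ioc 0 (β - Fintype.card (Σ x, D x) * ε),
        ∫⁻ ω, (Γ.maxPathProb o X ω)⁻¹ ^ s ∂Measure.pi (fun x => dirichlet (α x)) ≤
          ENNReal.ofReal (C * ε⁻¹ ^ Fintype.card (Σ x, D x)) := by
  obtain ⟨C, hC, hmonomial⟩ := exists_lintegral_envMonomial_le hα
  have hcard : (1 : ℝ) ≤ Fintype.card (D x) := by
    exact_mod_cast (Fintype.card_pos : 0 < Fintype.card (D x))
  have hsmall : ∀ᶠ ε in nhds (0 : ℝ), ∀ e : Σ x, D x, ε ≤ α e.1 e.2 :=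
    eventually_all.2 fun e => eventually_le_nhds (hα e.1 e.2)
  refine ⟨(Fintype.card (D x) : ℝ) ^ β * C, by positivity, ?_⟩
  filter_upwards [nhdsWithin_le_nhds hsmall, self_mem_nhdsWithin,
    nhdsWithin_le_nhds (eventually_le_nhds one_pos)] with ε hε (hε0 : 0 < ε) hε1 s hs
  have hsβ : s ≤ β := hs.2.trans (sub_le_self _ (by positivity))
  calc ∫⁻ ω, (Γ.maxPathProb o X ω)⁻¹ ^ s ∂Measure.pi (fun x => dirichlet (α x))
      ≤ ∫⁻ ω, ENNReal.ofReal ((Fintype.card (D x) : ℝ) ^ s) *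
          envMonomial (fun e => ε - α e.1 e.2) ω ∂Measure.pi (fun x => dirichlet (α x)) := by
        refine lintegral_mono fun ω => ?_
        simpa using inv_maxPathProb_rpow_le hsrc (a := fun e => α e.1 e.2 - ε)
          (fun e => sub_nonneg.2 (hε e)) hs.1 (fun U hU hUX => hs.2.trans <|
            (sub_le_sub_right (hcut U hU hUX) _).trans (cutWeight_sub_le_cutWeight _ _ hε0.le)) ω
    _ ≤ ENNReal.ofReal ((Fintype.card (D x) : ℝ) ^ β) *
          ENNReal.ofReal (C * ε⁻¹ ^ Fintype.card (Σ x, D x)) := by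
        rw [lintegral_const_mul _ (measurable_envMonomial _)]
        gcongr
        exact hmonomial ε ⟨hε0, hε1⟩
    _ = ENNReal.ofReal ((Fintype.card (D x) : ℝ) ^ β * C * ε⁻¹ ^ Fintype.card (Σ x, D x)) := by
        rw [← ENNReal.ofReal_mul (by positivity), mul_assoc]

lemma exists_eventually_measure_inv_maxPathProb_le [Fintype ι] [∀ x, Nonempty (D x)]
    (hsrc : ∀ i, Γ.src ⟨x, i⟩ = o) {α : ∀ x, D x → ℝ} (hα : ∀ x i, 0 < α x i) {β : ℝ}
    (hβ : 0 < β)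
    (hcut : ∀ U, Γ.IsCluster o U → Disjoint U X → β ≤ Γ.cutWeight (fun e => α e.1 e.2) U) :
    ∃ C : ℝ, 0 < C ∧ ∀ᶠ t : ℝ in atTop, Measure.pi (fun x => dirichlet (α x))
        {ω | ENNReal.ofReal t < (Γ.maxPathProb o X ω)⁻¹} ≤
      ENNReal.ofReal (C * Real.log t ^ (Fintype.card (Σ x, D x) : ℝ) / t ^ β) := by
  obtain ⟨C, hC, hmoment⟩ := exists_lintegral_inv_maxPathProb_rpow_le hsrc hα hcut
  refine ⟨C * Real.exp (Fintype.card (Σ x, D x)), by positivity, ?_⟩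
  refine eventually_measure_lt_le measurable_maxPathProb.inv.aemeasurable hβ ?_
  filter_upwards [hmoment, eventually_lt_sub_mul hβ _] with ε hε hpos
  exact hε _ ⟨hpos, le_rfl⟩

lemma lintegral_inv_maxPathProb_rpow_lt_top [Fintype ι] [∀ x, Nonempty (D x)]
    (hsrc : ∀ i, Γ.src ⟨x, i⟩ = o) {α : ∀ x, D x → ℝ} (hα : ∀ x i, 0 < α x i) {β : ℝ}
    (hcut : ∀ U, Γ.IsCluster o U → Disjoint U X → β ≤ Γ.cutWeight (fun e => α e.1 e.2) U)
    {s : ℝ} (hs : s ∈ Set.Ioo 0 β) :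
    ∫⁻ ω, (Γ.maxPathProb o X ω)⁻¹ ^ s ∂Measure.pi (fun x => dirichlet (α x)) < ∞ := by
  obtain ⟨C, -, hmoment⟩ := exists_lintegral_inv_maxPathProb_rpow_le hsrc hα hcut
  obtain ⟨ε, hε, hsε⟩ := (hmoment.and (eventually_lt_sub_mul hs.2 _)).exists
  exact (hε s ⟨hs.1, hsε.le⟩).trans_lt ENNReal.ofReal_lt_top

end DirectedMultigraph

end PathProbability

section FirstLoop

lemma hitTime_lt_of_injOn {W : Type*} {Z : ℕ → W} {n : ℕ} (hZ : Set.InjOn Z (Set.Iic n)) :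
    hitTime (Z n) Z < min (returnTime (Z 0) Z) (loopTime Z) := by
  have hloop {k m : ℕ} (hmk : m < k) (hkm : Z k = Z m) : n < k := by
    by_contra! hk
    exact hmk.ne' (hZ hk (hmk.le.trans hk) hkm)
  have hit : hitTime (Z n) Z ≤ n := iInf₂_le (f := fun (k : ℕ) (_ : Z k = Z n) => (k : ℕ∞)) n rfl
  have hlt : (n : ℕ∞) < ((n + 1 : ℕ) : ℕ∞) := Nat.cast_lt.2 n.lt_succ_self
  refine hit.trans_lt (hlt.trans_le (le_min ?_ ?_))
  · exact le_iInf₂ fun k hk => Nat.cast_le.2 (hloop hk.1 hk.2)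
  · exact le_iInf₂ fun k ⟨_, m, hm, hkm⟩ => Nat.cast_le.2 (hloop hm hkm)

end FirstLoop

section Walk

variable {W : Type*} [Fintype W] {G : Digraph W} {δ : W}
  [MeasurableSpace W] [DiscreteMeasurableSpace W]

lemma walkLaw_setOf_forall_le_succ (ω : Env G δ) (x : W) (z : ℕ → W) (n : ℕ) :
    walkLaw ω x {Z | ∀ i ≤ n + 1, Z i = z i} =
      walkLaw ω x {Z | ∀ i ≤ n, Z i = z i} * step ω (z n) (z (n + 1)) := by
  let past : Set (Finset.Iic n → W) := {(fun i => z i : Finset.Iic n → W)}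
  have hpast : {Z : ℕ → W | ∀ i ≤ n, Z i = z i} =
      Preorder.frestrictLe (π := fun _ => W) n ⁻¹' past := by
    ext Z
    simp [past, funext_iff]
  have hnext : {Z : ℕ → W | ∀ i ≤ n + 1, Z i = z i} =
      (fun Z => (Preorder.frestrictLe (π := fun _ => W) n Z, Z (n + 1))) ⁻¹'
        (past ×ˢ {z (n + 1)}) := by
    ext Z
    simp [past, funext_iff, Nat.le_succ_iff, or_imp, forall_and]
  rw [hnext, hpast, walkLaw, ← Measure.map_apply (by fun_prop) (by measurability),
    ← Kernel.partialTraj_compProd_eq_map_traj zero_le,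
    Measure.compProd_apply_prod (by measurability) (by measurability), lintegral_singleton,
    ← Measure.map_apply (Preorder.measurable_frestrictLe n) (by measurability),
    Kernel.traj_map_frestrictLe_apply, mul_comm]
  congr 1
  exact PMF.toMeasure_apply_singleton _ _ (measurableSet_singleton _)

lemma walkLaw_setOf_forall_le (ω : Env G δ) (z : ℕ → W) (n : ℕ) :
    walkLaw ω (z 0) {Z | ∀ i ≤ n, Z i = z i} =
      ∏ i ∈ Finset.range n, step ω (z i) (z (i + 1)) := by
  induction n with
  | zero =>
    have hstart : {Z : ℕ → W | ∀ i ≤ 0, Z i = z i} =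
        Preorder.frestrictLe (π := fun _ => W) 0 ⁻¹' {fun _ => z 0} := by
      ext Z
      simp [funext_iff]
    rw [hstart, walkLaw,
      ← Measure.map_apply (Preorder.measurable_frestrictLe 0) (by measurability),
      Kernel.traj_map_frestrictLe_apply, Kernel.partialTraj_self, Kernel.id_apply]
    simp
  | succ n ih => rw [walkLaw_setOf_forall_le_succ, ih, Finset.prod_range_succ]

end Walk

section FiniteGraph

variable {W : Type*} {G : Digraph W} {δ : W}

/-- The edges of `G` that exit the vertices other than `δ`, sorted by their tails as in an
environment. -/
def exitGraph (G : Digraph W) (δ : W) :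
    DirectedMultigraph W (Σ x : {x : W // x ≠ δ}, Out G x.1) where
  src e := e.1.1
  tgt e := e.2.1

variable [Fintype W]

open scoped Classical in
lemma step_exitGraph (ω : Env G δ) (e : Σ x : {x : W // x ≠ δ}, Out G x.1) :
    step ω ((exitGraph G δ).src e) ((exitGraph G δ).tgt e) =
      ENNReal.ofReal ((ω e.1).1 e.2) := by
  obtain ⟨⟨x, hx⟩, y⟩ := e
  rw [exitGraph, step, dif_neg hx, PMF.map_apply, tsum_eq_single y]
  · simp [exitPMF]
  · intro y' hy'
    simp [Subtype.coe_inj, hy'.symm]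

open scoped Classical in
lemma prod_step_eq_ofReal_pathProb (ω : Env G δ) {o v : W}
    {p : List (Σ x : {x : W // x ≠ δ}, Out G x.1)} (hp : (exitGraph G δ).IsSimplePath o p v) :
    ∏ i ∈ Finset.range p.length, step ω ((o :: p.map (exitGraph G δ).tgt).getD i δ)
        ((o :: p.map (exitGraph G δ).tgt).getD (i + 1) δ) =
      ENNReal.ofReal (pathProb ω p) := by
  induction p generalizing o with
  | nil => simp [pathProb]
  | cons e p ih =>
    obtain ⟨rfl, -, hp⟩ := DirectedMultigraph.isSimplePath_cons.1 hp
    rw [List.length_cons, Finset.prod_range_succ', pathProb_cons,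
      ENNReal.ofReal_mul ((ω e.1).2.1 e.2).le, ← step_exitGraph, mul_comm, ← ih hp]
    rfl

open scoped Classical in
lemma gamma_le_inv_maxPathProb [MeasurableSpace W] [DiscreteMeasurableSpace W] (ω : Env G δ)
    (o : W) : gamma ω o ≤ ((exitGraph G δ).maxPathProb o {δ} ω)⁻¹ := by
  refine ENNReal.inv_le_inv.2 (iSup₂_le ?_)
  rintro p ⟨v, rfl, hp⟩
  let l := o :: p.map (exitGraph G v).tgt
  have hlength : l.length = p.length + 1 := by simp [l]
  have hlast : l.getD p.length v = v := by
    rw [show l = p.map (exitGraph G v).src ++ [v] from hp.1.symm]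
    simp
  have hinj : Set.InjOn (fun i => l.getD i v) (Set.Iic p.length) := by
    intro i (hi : i ≤ _) j (hj : j ≤ _) (hij : l.getD i v = l.getD j v)
    rw [List.getD_eq_getElem _ _ (by omega), List.getD_eq_getElem _ _ (by omega)] at hij
    exact hp.2.getElem_inj_iff.1 hij
  rw [← prod_step_eq_ofReal_pathProb ω hp, ← walkLaw_setOf_forall_le ω fun i => l.getD i v]
  refine measure_mono fun Z hZ => ?_
  have := hitTime_lt_of_injOn (hinj.congr fun i hi => (hZ i hi).symm)
  rwa [hZ _ le_rfl, hlast, hZ 0 (Nat.zero_le _)] at this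

end FiniteGraph

section ExitSum

variable {W : Type*} {G : Digraph W} {δ o : W}

lemma IsCemetery.nonempty_out (hG : IsCemetery G δ) (x : {x : W // x ≠ δ}) :
    Nonempty (Out G x.1) := by
  rcases Relation.ReflTransGen.cases_head (hG.2 x.1) with h | ⟨z, hz, -⟩
  · exact absurd h x.2
  · exact ⟨⟨z, hz⟩⟩

lemma IsCemetery.exists_adj_exit (hG : IsCemetery G δ) {U : Set W} (ho : o ∈ U) (hδ : δ ∉ U) :
    ∃ a b, G.Adj a b ∧ a ∈ U ∧ b ∉ U := by
  by_contra! h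
  have hclosed {y : W} (hy : Relation.ReflTransGen G.Adj o y) : y ∈ U := by
    induction hy with
    | refl => exact ho
    | tail _ hadj ih => exact h _ _ hadj ih
  exact hδ (hclosed (hG.2 o))

lemma exitSum_pos [Fintype W] (hG : IsCemetery G δ) {α : W → W → ℝ}
    (hα : ∀ x y, G.Adj x y → 0 < α x y) {A : Set (W × W)} (hA : ∀ e ∈ A, G.Adj e.1 e.2)
    (ho : o ∈ tails A) : 0 < exitSum G α A := by
  have hδ : δ ∉ tails A := by
    rintro ⟨e, he, rfl⟩
    exact hG.1 e.2 (hA e he)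
  obtain ⟨a, b, hab, ha, hb⟩ := hG.exists_adj_exit ho hδ
  classical
  exact Finset.sum_pos (fun e he => hα _ _ (Finset.mem_filter.1 he).2.1)
    ⟨(a, b), Finset.mem_filter.2 ⟨Finset.mem_univ _, hab, ha, hb⟩⟩

/-- The set of the edges of `G` between vertices of `U`. -/
def edgesIn (G : Digraph W) (U : Set W) : Set (W × W) := {e | G.Adj e.1 e.2 ∧ e.1 ∈ U ∧ e.2 ∈ U}

variable {U : Set W}

lemma reflTransGen_edgesIn (hU : (exitGraph G δ).IsCluster o U) {v : W} (hv : v ∈ U) :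
    Relation.ReflTransGen (fun a b => (a, b) ∈ edgesIn G U) o v := by
  refine Relation.ReflTransGen.mono ?_ _ _ (hU.2.2 v hv)
  rintro a b ⟨ha, hb, e, rfl, rfl⟩
  exact ⟨e.2.2, ha, hb⟩

lemma tails_edgesIn (hsymm : ∀ x y, G.Adj x y → y ≠ δ → G.Adj y x)
    (hU : (exitGraph G δ).IsCluster o U) (hδ : δ ∉ U) : tails (edgesIn G U) = U := by
  refine Set.Subset.antisymm ?_ fun x hx => ?_
  · rintro _ ⟨e, he, rfl⟩
    exact he.2.1
  · rcases Relation.ReflTransGen.cases_tail (reflTransGen_edgesIn hU hx) with rfl | ⟨z, -, hz⟩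
    · obtain ⟨ho, ⟨e, rfl, he⟩, -⟩ := hU
      exact ⟨(_, _), ⟨e.2.2, ho, he⟩, rfl⟩
    · exact ⟨(x, z), ⟨hsymm z x hz.1 (ne_of_mem_of_not_mem hx hδ), hx, hz.2.1⟩, rfl⟩

lemma isStronglyConnected_edgesIn (hsymm : ∀ x y, G.Adj x y → y ≠ δ → G.Adj y x)
    (hU : (exitGraph G δ).IsCluster o U) (hδ : δ ∉ U) :
    IsStronglyConnected G (edgesIn G U) := by
  have : Std.Symm fun a b => (a, b) ∈ edgesIn G U :=
    ⟨fun a b h => ⟨hsymm a b h.1 (ne_of_mem_of_not_mem h.2.2 hδ), h.2.2, h.2.1⟩⟩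
  have hmem {x : W} (hx : x ∈ heads (edgesIn G U) ∪ tails (edgesIn G U)) : x ∈ U := by
    rcases hx with ⟨e, he, rfl⟩ | ⟨e, he, rfl⟩
    exacts [he.2.2, he.2.1]
  exact ⟨fun e he => he.1, fun x hx y hy =>
    (Std.Symm.symm _ _ (reflTransGen_edgesIn hU (hmem hx))).trans
      (reflTransGen_edgesIn hU (hmem hy))⟩

open scoped Classical in
lemma cutWeight_exitGraph [Fintype W] (hG : IsCemetery G δ) (α : W → W → ℝ) (U : Set W) :
    (exitGraph G δ).cutWeight (fun e => α e.1.1 e.2.1) U =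
      ∑ e : W × W with G.Adj e.1 e.2 ∧ e.1 ∈ U ∧ e.2 ∉ U, α e.1 e.2 := by
  refine Finset.sum_bij (fun e _ => (e.1.1, e.2.1)) ?_ ?_ ?_ fun e _ => rfl
  · intro e he
    exact Finset.mem_filter.2 ⟨Finset.mem_univ _, e.2.2, (Finset.mem_filter.1 he).2⟩
  · rintro ⟨⟨x, hx⟩, ⟨y, hy⟩⟩ _ ⟨⟨x', hx'⟩, ⟨y', hy'⟩⟩ _ h
    obtain ⟨rfl, rfl⟩ := Prod.mk.inj h
    rfl
  · rintro ⟨x, y⟩ h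
    obtain ⟨-, hxy, hcut⟩ := Finset.mem_filter.1 h
    exact ⟨⟨⟨x, fun hx => hG.1 y (hx ▸ hxy)⟩, ⟨y, hxy⟩⟩,
      Finset.mem_filter.2 ⟨Finset.mem_univ _, hcut⟩, rfl⟩

open scoped Classical in
lemma cutWeight_mem_exitSums [Fintype W] (hG : IsCemetery G δ)
    (hsymm : ∀ x y, G.Adj x y → y ≠ δ → G.Adj y x) (α : W → W → ℝ)
    (hU : (exitGraph G δ).IsCluster o U) (hUδ : Disjoint U {δ}) :
    (exitGraph G δ).cutWeight (fun e => α e.1.1 e.2.1) U ∈ exitSums G α o := by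
  have hδ : δ ∉ U := Set.disjoint_singleton_right.1 hUδ
  have htails := tails_edgesIn hsymm hU hδ
  refine ⟨edgesIn G U, isStronglyConnected_edgesIn hsymm hU hδ, htails.symm ▸ hU.1, ?_⟩
  rw [cutWeight_exitGraph hG, exitSum, htails]

end ExitSum

section GammaTail

variable {W : Type*} [Fintype W] [MeasurableSpace W] [DiscreteMeasurableSpace W]
  {G : Digraph W} {δ o : W}

lemma exists_eventually_measure_gamma_le (hG : IsCemetery G δ)
    (hsymm : ∀ x y, G.Adj x y → y ≠ δ → G.Adj y x) {α : W → W → ℝ}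
    (hα : ∀ x y, G.Adj x y → 0 < α x y) (ho : o ≠ δ) {β : ℝ} (hβ : IsLeast (exitSums G α o) β) :
    ∃ C r : ℝ, 0 < C ∧ 0 < r ∧ ∀ᶠ t : ℝ in atTop,
      envLaw G δ α {ω | ENNReal.ofReal t < gamma ω o} ≤
        ENNReal.ofReal (C * Real.log t ^ r / t ^ β) := by
  classical
  have := hG.nonempty_out
  have hβ0 : 0 < β := by
    obtain ⟨A, hA, hoA, rfl⟩ := hβ.1
    exact exitSum_pos hG hα hA.1 hoA
  obtain ⟨C, hC, htail⟩ := DirectedMultigraph.exists_eventually_measure_inv_maxPathProb_le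
    (Γ := exitGraph G δ) (x := ⟨o, ho⟩) (X := {δ}) (fun _ => rfl)
    (α := fun x y => α x.1 y.1) (fun x y => hα _ _ y.2) hβ0
    fun U hU hUδ => hβ.2 (cutWeight_mem_exitSums hG hsymm α hU hUδ)
  have : Nonempty (Σ x : {x // x ≠ δ}, Out G x.1) := ⟨⟨o, ho⟩, (hG.nonempty_out ⟨o, ho⟩).some⟩
  have hcard : (0 : ℝ) < Fintype.card (Σ x : {x // x ≠ δ}, Out G x.1) :=
    Nat.cast_pos.2 Fintype.card_pos
  refine ⟨C, _, hC, hcard, ?_⟩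
  filter_upwards [htail] with t ht
  exact (measure_mono fun ω hω => hω.trans_le (gamma_le_inv_maxPathProb ω o)).trans ht

lemma eventually_measure_gamma_eq_zero (hG : IsCemetery G δ)
    (hsymm : ∀ x y, G.Adj x y → y ≠ δ → G.Adj y x) {α : W → W → ℝ} (ho : o ≠ δ)
    (hempty : exitSums G α o = ∅) :
    ∀ᶠ t : ℝ in atTop, envLaw G δ α {ω | ENNReal.ofReal t < gamma ω o} = 0 := by
  classical
  have := hG.nonempty_out ⟨o, ho⟩
  have hbound (ω : Env G δ) : gamma ω o ≤ Fintype.card (Out G o) :=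
    (gamma_le_inv_maxPathProb ω o).trans <|
      DirectedMultigraph.inv_maxPathProb_le_card (Γ := exitGraph G δ) (x := ⟨o, ho⟩)
        (X := {δ}) (fun _ => rfl)
        (fun U hU hUδ => hempty.subset (cutWeight_mem_exitSums hG hsymm α hU hUδ)) ω
  filter_upwards [eventually_ge_atTop (Fintype.card (Out G o) : ℝ)] with t ht
  have hnone : {ω : Env G δ | ENNReal.ofReal t < gamma ω o} = ∅ := by
    refine Set.eq_empty_iff_forall_notMem.2 fun ω hω => hω.not_ge ((hbound ω).trans ?_)
    rw [← ENNReal.ofReal_natCast]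
    exact ENNReal.ofReal_le_ofReal ht
  rw [hnone, measure_empty]

end GammaTail

section Isoperimetry

variable {d : ℕ}

/-- The axis of a direction. -/
def axis : Dir d → Fin d := Sum.elim id id

lemma unitVec_apply_axis_ne_zero (i : Dir d) : unitVec i (axis i) ≠ 0 := by
  rcases i with i | i <;> simp [unitVec, axis]

lemma unitVec_apply_of_ne_axis {i : Dir d} {j : Fin d} (h : j ≠ axis i) : unitVec i j = 0 := by
  rcases i with i | i <;> simp_all [unitVec, axis]

/-- The points of `U` from which a step in the direction `i` exits `U`. -/
def exitSites (U : Finset (Fin d → ℤ)) (i : Dir d) : Finset (Fin d → ℤ) :=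
  {z ∈ U | z + unitVec i ∉ U}

variable {U : Finset (Fin d → ℤ)} {y : Fin d → ℤ}

lemma exists_add_nsmul_mem_exitSites (hy : y ∈ U) (i : Dir d) :
    ∃ n : ℕ, y + n • unitVec i ∈ exitSites U i := by
  by_contra! h
  have hall (n : ℕ) : y + n • unitVec i ∈ U := by
    induction n with
    | zero => simpa using hy
    | succ n ih =>
      have := h n
      simp only [exitSites, Finset.mem_filter, not_and, not_not] at this
      simpa only [add_smul, one_smul, add_assoc] using this ih
  refine Set.infinite_of_injective_forall_mem (f := fun n : ℕ => y + n • unitVec i)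
    (fun m n hmn => ?_) hall U.finite_toSet
  simpa [unitVec_apply_axis_ne_zero] using congrFun hmn (axis i)

lemma one_le_card_exitSites (hy : y ∈ U) (i : Dir d) : 1 ≤ (exitSites U i).card :=
  Finset.card_pos.2 ⟨_, (exists_add_nsmul_mem_exitSites hy i).choose_spec⟩

lemma two_le_card_exitSites {i k : Dir d} (hy : y ∈ U) (hyk : y + unitVec k ∈ U)
    (hik : axis k ≠ axis i) : 2 ≤ (exitSites U i).card := by
  obtain ⟨m, hm⟩ := exists_add_nsmul_mem_exitSites hy i
  obtain ⟨n, hn⟩ := exists_add_nsmul_mem_exitSites hyk i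
  refine Finset.one_lt_card.2 ⟨_, hm, _, hn, fun h => unitVec_apply_axis_ne_zero k ?_⟩
  simpa [unitVec_apply_of_ne_axis hik] using congrFun h (axis k)

lemma kappa_le_sum_mul {a n : Dir d → ℝ} (ha : ∀ i, 0 ≤ a i) (j : Fin d) (hone : ∀ i, 1 ≤ n i)
    (htwo : ∀ i, j ≠ axis i → 2 ≤ n i) : kappa a ≤ ∑ i, n i * a i := by
  have hmax : a (Sum.inl j) + a (Sum.inr j) ≤ ⨆ i : Fin d, (a (Sum.inl i) + a (Sum.inr i)) :=
    le_ciSup (f := fun i : Fin d => a (Sum.inl i) + a (Sum.inr i))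
      (Set.finite_range _).bddAbove j
  have haxis : ∑ i, (if j = axis i then a i else 0) = a (Sum.inl j) + a (Sum.inr j) := by
    rw [Fintype.sum_sum_type]
    exact congrArg₂ _ (Fintype.sum_ite_eq j _) (Fintype.sum_ite_eq j _)
  have hterm (i : Dir d) : 2 * a i - (if j = axis i then a i else 0) ≤ n i * a i := by
    split_ifs with hi
    · linarith [mul_le_mul_of_nonneg_right (hone i) (ha i)]
    · linarith [mul_le_mul_of_nonneg_right (htwo i hi) (ha i)]
  calc kappa a ≤ 2 * ∑ i, a i - ∑ i, (if j = axis i then a i else 0) := by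
        rw [kappa, haxis]
        linarith
    _ = ∑ i, (2 * a i - (if j = axis i then a i else 0)) := by
        rw [Finset.sum_sub_distrib, Finset.mul_sum]
    _ ≤ ∑ i, n i * a i := Finset.sum_le_sum fun i _ => hterm i

/-- The edges of `ℤ^d` that exit the points of `S`. -/
def latticeGraph (S : Finset (Fin d → ℤ)) :
    DirectedMultigraph (Fin d → ℤ) (Σ _ : S, Dir d) where
  src e := e.1.1
  tgt e := e.1.1 + unitVec e.2

lemma cutWeight_latticeGraph {S : Finset (Fin d → ℤ)} (hUS : U ⊆ S) (a : Dir d → ℝ) :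
    (latticeGraph S).cutWeight (fun e => a e.2) U = ∑ i, (exitSites U i).card * a i := by
  classical
  have hsites (i : Dir d) : {z ∈ S | z ∈ U ∧ z + unitVec i ∉ U} = exitSites U i := by
    ext z
    simp only [exitSites, Finset.mem_filter]
    exact ⟨fun h => h.2, fun h => ⟨hUS h.1, h⟩⟩
  rw [DirectedMultigraph.cutWeight, Finset.sum_filter, Fintype.sum_sigma, Finset.sum_comm]
  refine Finset.sum_congr rfl fun i _ => ?_
  rw [← hsites, ← nsmul_eq_mul, ← Finset.sum_const, Finset.sum_filter, ← Finset.sum_coe_sort S]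
  simp only [latticeGraph, Finset.mem_coe]

lemma kappa_le_cutWeight {S : Finset (Fin d → ℤ)} {a : Dir d → ℝ} (ha : ∀ i, 0 ≤ a i)
    {V : Set (Fin d → ℤ)} (hV : (latticeGraph S).IsCluster y V) (hVS : V ⊆ S) :
    kappa a ≤ (latticeGraph S).cutWeight (fun e => a e.2) V := by
  lift V to Finset (Fin d → ℤ) using S.finite_toSet.subset hVS
  obtain ⟨hy, ⟨⟨z, k⟩, rfl, hk⟩, -⟩ := hV
  rw [cutWeight_latticeGraph (Finset.coe_subset.1 hVS)]
  exact kappa_le_sum_mul ha (axis k) (fun i => mod_cast one_le_card_exitSites hy i)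
    fun i hi => mod_cast two_le_card_exitSites hy hk hi

end Isoperimetry

section Lattice

variable {d : ℕ}

lemma trail_latticeGraph {S : Finset (Fin d → ℤ)} {x v : Fin d → ℤ} {p : List (Σ _ : S, Dir d)}
    (hp : (latticeGraph S).IsSimplePath x p v) :
    trail x (p.map Sigma.snd) = p.map (latticeGraph S).tgt := by
  induction p generalizing x with
  | nil => rfl
  | cons e p ih =>
    obtain ⟨rfl, -, hp⟩ := DirectedMultigraph.isSimplePath_cons.1 hp
    exact congrArg _ (ih hp)

lemma pathWeight_latticeGraph (ω : LatticeEnv d) {S : Finset (Fin d → ℤ)} {x v : Fin d → ℤ}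
    {p : List (Σ _ : S, Dir d)} (hp : (latticeGraph S).IsSimplePath x p v) :
    pathWeight ω x (p.map Sigma.snd) = pathProb (S.restrict ω) p := by
  induction p generalizing x with
  | nil => rfl
  | cons e p ih =>
    obtain ⟨rfl, -, hp⟩ := DirectedMultigraph.isSimplePath_cons.1 hp
    rw [pathProb_cons, ← ih hp]
    rfl

variable {Λ : Finset (Fin d → ℤ)} {x : Fin d → ℤ}

lemma isExitPath_of_isSimplePath {S : Finset (Fin d → ℤ)} (hS : ∀ y, y ∈ S ↔ y - x ∈ Λ)
    {v : Fin d → ℤ} {p : List (Σ _ : S, Dir d)} (hp : (latticeGraph S).IsSimplePath x p v)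
    (hv : v ∉ S) : IsExitPath Λ x (p.map Sigma.snd) := by
  have hpath : x :: trail x (p.map Sigma.snd) = p.map (latticeGraph S).src ++ [v] := by
    rw [trail_latticeGraph hp, hp.1]
  refine ⟨trail_latticeGraph hp ▸ hp.2, ?_, ?_⟩
  · rw [hpath, List.dropLast_concat]
    rintro y hy
    obtain ⟨e, -, rfl⟩ := List.mem_map.1 hy
    exact (hS _).1 e.1.2
  · simpa only [hpath, List.getLast_concat, ← hS] using hv

lemma latticeGamma_le_inv_maxPathProb {S : Finset (Fin d → ℤ)} (hS : ∀ y, y ∈ S ↔ y - x ∈ Λ)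
    (ω : LatticeEnv d) :
    latticeGamma Λ ω x ≤ ((latticeGraph S).maxPathProb x (↑S)ᶜ (S.restrict ω))⁻¹ := by
  refine ENNReal.inv_le_inv.2 (iSup₂_le ?_)
  rintro p ⟨v, hv, hp⟩
  rw [← pathWeight_latticeGraph ω hp]
  exact ENNReal.le_tsum (f := fun σ : {σ : List (Dir d) // IsExitPath Λ x σ} =>
    ENNReal.ofReal (pathWeight ω x σ.1)) ⟨_, isExitPath_of_isSimplePath hS hp hv⟩

lemma lintegral_latticeGamma_rpow_lt_top_of_pos {α : Dir d → ℝ} (hα : ∀ i, 0 < α i)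
    (hd : 1 ≤ d) (h0 : 0 ∈ Λ) {s : ℝ} (hs : s ∈ Set.Ioo 0 (kappa α)) :
    ∫⁻ ω, latticeGamma Λ ω x ^ s ∂latticeLaw α < ∞ := by
  have : Nonempty (Dir d) := ⟨Sum.inl ⟨0, hd⟩⟩
  have := isProbabilityMeasure_dirichlet hα
  let S : Finset (Fin d → ℤ) := Λ.map (addRightEmbedding x)
  have hS (y : Fin d → ℤ) : y ∈ S ↔ y - x ∈ Λ := by simp [S, ← eq_sub_iff_add_eq]
  have hxS : x ∈ S := by simpa [hS] using h0
  let f (η : S → Simplex (Dir d)) : ℝ≥0∞ := ((latticeGraph S).maxPathProb x (↑S)ᶜ η)⁻¹ ^ s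
  have hf : Measurable f := DirectedMultigraph.measurable_maxPathProb.inv.pow_const s
  calc ∫⁻ ω, latticeGamma Λ ω x ^ s ∂latticeLaw α ≤ ∫⁻ ω, f (S.restrict ω) ∂latticeLaw α :=
        lintegral_mono fun ω =>
          ENNReal.rpow_le_rpow (latticeGamma_le_inv_maxPathProb hS ω) hs.1.le
    _ = ∫⁻ η, f η ∂Measure.pi fun _ => dirichlet α := by
        rw [← lintegral_map hf S.measurable_restrict, latticeLaw,
          Measure.infinitePi_map_restrict]
    _ < ∞ := DirectedMultigraph.lintegral_inv_maxPathProb_rpow_lt_top (x := (⟨x, hxS⟩ : S))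
        (fun _ => rfl) (fun _ => hα)
        (fun U hU hUS => kappa_le_cutWeight (fun i => (hα i).le) hU
          (Set.disjoint_compl_right_iff_subset.1 hUS)) hs

lemma pathWeight_mem_Icc (ω : LatticeEnv d) (x : Fin d → ℤ) (σ : List (Dir d)) :
    pathWeight ω x σ ∈ Set.Icc 0 1 := by
  induction σ generalizing x with
  | nil => simp [pathWeight]
  | cons i σ ih =>
    have hω := (ω x).2.1 i
    exact ⟨mul_nonneg hω.le (ih _).1, mul_le_one₀ (simplex_le_one _ _) (ih _).1 (ih _).2⟩

lemma length_trail (x : Fin d → ℤ) (σ : List (Dir d)) : (trail x σ).length = σ.length := by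
  induction σ generalizing x with
  | nil => rfl
  | cons i σ ih => exact congrArg _ (ih _)

instance finite_isExitPath (Λ : Finset (Fin d → ℤ)) (x : Fin d → ℤ) :
    Finite {σ : List (Dir d) // IsExitPath Λ x σ} := by
  refine ((List.finite_length_le (Dir d) Λ.card).subset fun σ hσ => ?_).to_subtype
  let l := (x :: trail x σ).dropLast.map (· - x)
  have hnodup : l.Nodup := (hσ.1.sublist (List.dropLast_sublist _)).map sub_left_injective
  have hsub : l.toFinset ⊆ Λ := by
    intro z hz
    obtain ⟨y, hy, rfl⟩ := List.mem_map.1 (List.mem_toFinset.1 hz)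
    exact hσ.2.1 y hy
  have hcard := Finset.card_le_card hsub
  rw [List.toFinset_card_of_nodup hnodup] at hcard
  simpa [l, length_trail] using hcard

lemma latticeGamma_rpow_le_of_nonpos (ω : LatticeEnv d) {s : ℝ} (hs : s ≤ 0) :
    latticeGamma Λ ω x ^ s ≤ (Nat.card {σ : List (Dir d) // IsExitPath Λ x σ} : ℝ≥0∞) ^ (-s) := by
  rw [latticeGamma, ENNReal.inv_rpow, ← ENNReal.rpow_neg]
  refine ENNReal.rpow_le_rpow ?_ (neg_nonneg.2 hs)
  calc ∑' σ : {σ : List (Dir d) // IsExitPath Λ x σ}, ENNReal.ofReal (pathWeight ω x σ.1)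
      ≤ ∑' _ : {σ : List (Dir d) // IsExitPath Λ x σ}, 1 :=
        ENNReal.tsum_le_tsum fun σ => ENNReal.ofReal_le_one.2 (pathWeight_mem_Icc ω x σ.1).2
    _ = _ := by simp [ENat.card_eq_coe_natCard]

lemma lintegral_latticeGamma_rpow_lt_top {α : Dir d → ℝ} (hα : ∀ i, 0 < α i) (hd : 1 ≤ d)
    (h0 : 0 ∈ Λ) {s : ℝ} (hs : s < kappa α) :
    ∫⁻ ω, latticeGamma Λ ω x ^ s ∂latticeLaw α < ∞ := by
  rcases le_or_gt s 0 with hs0 | hs0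
  · have : Nonempty (Dir d) := ⟨Sum.inl ⟨0, hd⟩⟩
    have := isProbabilityMeasure_dirichlet hα
    have : IsProbabilityMeasure (latticeLaw α) :=
      inferInstanceAs (IsProbabilityMeasure (Measure.infinitePi fun _ => dirichlet α))
    refine (lintegral_mono fun ω => latticeGamma_rpow_le_of_nonpos ω hs0).trans_lt ?_
    rw [lintegral_const, measure_univ, mul_one]
    exact ENNReal.rpow_lt_top_of_nonneg (neg_nonneg.2 hs0) (ENNReal.natCast_ne_top _)
  · exact lintegral_latticeGamma_rpow_lt_top_of_pos hα hd h0 ⟨hs0, hs⟩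

end Lattice

end RWDE

theorem mainTheorem7_general :
    (∀ (W : Type*) [Fintype W] [MeasurableSpace W] [DiscreteMeasurableSpace W]
        (G : Digraph W) (δ : W) (α : W → W → ℝ) (o : W),
      RWDE.IsCemetery G δ →
      (∀ x y, G.Adj x y → y ≠ δ → G.Adj y x) →
      (∀ x y, G.Adj x y → 0 < α x y) →
      o ≠ δ →
      (∀ β : ℝ, IsLeast (RWDE.exitSums G α o) β →
        ∃ C r : ℝ, 0 < C ∧ 0 < r ∧ ∀ᶠ t : ℝ in Filter.atTop,
          RWDE.envLaw G δ α {ω | ENNReal.ofReal t < RWDE.gamma ω o} ≤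
            ENNReal.ofReal (C * Real.log t ^ r / t ^ β)) ∧
      (RWDE.exitSums G α o = ∅ → ∀ᶠ t : ℝ in Filter.atTop,
        RWDE.envLaw G δ α {ω | ENNReal.ofReal t < RWDE.gamma ω o} = 0)) ∧
    (∀ (d : ℕ) (α : RWDE.Dir d → ℝ) (Λ : Finset (Fin d → ℤ)),
      1 ≤ d →
      (∀ i, 0 < α i) →
      0 ∈ Λ →
      ∀ (x : Fin d → ℤ) (s : ℝ), s < RWDE.kappa α →
        ∫⁻ ω, RWDE.latticeGamma Λ ω x ^ s ∂(RWDE.latticeLaw α) < ⊤) :=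
  ⟨fun _ _ _ _ _ _ _ _ hG hsymm hα ho =>
    ⟨fun _ => RWDE.exists_eventually_measure_gamma_le hG hsymm hα ho,
      RWDE.eventually_measure_gamma_eq_zero hG hsymm ho⟩,
    fun _ _ _ hd hα h0 _ _ => RWDE.lintegral_latticeGamma_rpow_lt_top hα hd h0⟩

theorem mainTheorem7 :
    -- finite directed graphs with a cemetery vertex
    (∀ (W : Type*) [Fintype W] [MeasurableSpace W] [DiscreteMeasurableSpace W]
        (G : Digraph W) (δ : W) (α : W → W → ℝ) (o : W),
      RWDE.IsCemetery G δ →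
      (∀ x, ¬ G.Adj x x) →
      (∀ x y, G.Adj x y → y ≠ δ → G.Adj y x) →
      (∀ x y, G.Adj x y → 0 < α x y) →
      o ≠ δ →
      -- the bound with `β` the minimum of the (finitely many) `β_A`
      (∀ β : ℝ, IsLeast (RWDE.exitSums G α o) β →
        ∃ C r : ℝ, 0 < C ∧ 0 < r ∧ ∀ᶠ t : ℝ in Filter.atTop,
          RWDE.envLaw G δ α {ω | ENNReal.ofReal t < RWDE.gamma ω o} ≤
            ENNReal.ofReal (C * Real.log t ^ r / t ^ β)) ∧
      -- if there is no admissible `A`, the minimum is `+∞` and the bound is `0`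
      (RWDE.exitSums G α o = ∅ → ∀ᶠ t : ℝ in Filter.atTop,
        RWDE.envLaw G δ α {ω | ENNReal.ofReal t < RWDE.gamma ω o} = 0)) ∧
    -- the lattice `ℤ^d`
    (∀ (d : ℕ) (α : RWDE.Dir d → ℝ) (Λ : Finset (Fin d → ℤ)),
      1 ≤ d →
      (∀ i, 0 < α i) →
      0 ∈ Λ →
      RWDE.IsConnectedSet Λ →
      ∀ (x : Fin d → ℤ) (s : ℝ), s < RWDE.kappa α →
        ∫⁻ ω, RWDE.latticeGamma Λ ω x ^ s ∂(RWDE.latticeLaw α) < ⊤) :=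
  And.imp (fun hgraph W _ _ _ G δ α o hG _ => hgraph W G δ α o hG)
    (fun hlattice d α Λ hd hα h0 _ => hlattice d α Λ hd hα h0) mainTheorem7_general
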